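/- **Setting.** Let $X$ (states) and $A\neq\emptyset$ (actions) be finite sets, where $X$ is the disjoint union of layers $X_0,\dots,X_L$, $L\ge 1$, with $X_0=\{x_0\}$ and $X_L=\{x_L\}$; $k(x)$ denotes the index of the layer of $x$. A *transition function* $P$ assigns to every nonterminal state $x\in X_k$ ($k<L$) and action $a$ a probability distribution $P(\cdot\mid x,a)$ on $X_{k+1}$; a *policy* $\pi$ assigns to every nonterminal $x$ a probability distribution $\pi(\cdot\mid x)$ on $A$. Let $M=(X,A,P,\{\ell_t\}_{t=1}^T)$ be an episodic loop-free adversarial MDP, with a fixed transition function $P$ and an arbitrary fixed sequence of losses $\ell_t:X\times A\times X\to[0,1]^d$. For a random trajectory $U=(x_0,a_0,x_1,\dots,a_{L-1},x_L)$ with $a_k\sim\pi(\cdot\mid x_k)$, $x_{k+1}\sim P(\cdot\mid x_k,a_k)$, write $\mathbb E[\ell(U)\mid P,\pi]=(\mathbb E\,\ell(x_k,a_k,x_{k+1}))_{k=0}^{L-1}\in(\mathbb R^d)^L$ and $q^{P,\pi}(x,a,x')=\Pr[x_k=x,a_k=a,x_{k+1}=x']$ with $k=k(x)$. Let $\mathcal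 C:(\mathbb R^d)^L\to\mathbb R_{\ge0}$ be a performance criterion with a criterion function $f$: for every $\ell:X\times A\times X\to[0,1]^d$ the function $f(\cdot\,;\ell):[0,1]^{X\times A\times X}\to\mathbb R_{\ge0}$ is convex and $F$-Lipschitz for the $L_1$ norm, and $\mathcal C(\mathbb E[\ell(U)\mid P',\pi])=f(q^{P',\pi};\ell)$ for all transition functions $P'$ and policies $\pi$. For $q:X\times A\times X\to[0,1]$ supported on $\bigcup_{k<L}X_k\times A\times X_{k+1}$ let $$P^q(x'\mid x,a)=\frac{q(x,a,x')}{\sum_{y}q(x,a,y)},\qquad \pi^q(a\mid x)=\frac{\sum_{x'}q(x,a,x')}{\sum_{b,x'}q(x,b,x')},$$ and $D(q\|q')=\sum q\ln\frac{q}{q'}-q+q'$, the sum being over $(x,a,x')$. **Algorithm (UC-O-REPS)** with parameters $\eta>0$ and $0<\delta<1$. Start with $q_1(x,a,x')=\frac1{|X_k||A||X_{k+1}|}$ on $X_k\times A\times X_{k+1}$. In episode $t=1,\dots,T$ play $\pi_t=\pi^{q_t}$ in $M$, observe the trajectory $U_t$ and then $\ell_t$. The episodes are divided into epochs: the first one starts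 at episode $1$; with $N_i(x,a)$ and $M_i(x'\mid x,a)$ the numbers of visits of $(x,a)$ and of transitions $(x,a,x')$ before epoch $i$, and $n_i(x,a)$ the number of visits of $(x,a)$ in epoch $i$ so far, epoch $i$ ends after the first episode at whose end $n_i(x,a)\ge N_i(x,a)$ for some action $a$ and nonterminal state $x$. Let $\bar P_i(x'\mid x,a)=M_i(x'\mid x,a)/\max\{1,N_i(x,a)\}$ and $$\epsilon_i(x,a)=\sqrt{\frac{2|X_{k(x)+1}|\ln\frac{T|X||A|}{\delta}}{\max\{1,N_i(x,a)\}}}.$$ Let $\Delta(M,i)$ be the set of all $q$ as above such that $\sum_{x\in X_k,a,x'}q(x,a,x')=1$ for $0\le k<L$, $\sum_{x',a}q(x,a,x')=\sum_{x',a}q(x',a,x)$ for all $x\in X_k$, $0<k<L$, and $\|P^q(\cdot\mid x,a)-\bar P_i(\cdot\mid x,a)\|_1\le\epsilon_i(x,a)$ for all nonterminal $x$ and all $a$ with $\sum_{x'}q(x,a,x')>0$. With $i(t+1)$ the epoch containing episode $t+1$, the next occupancy measure is $$q_{t+1}\in\arg\min_{q\in\Delta(M,i(t+1))}\ \eta\langle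 q,z_t\rangle+D(q\|q_t),$$ where $z_t\in\partial f(q_t;\ell_t)$ is any subgradient of $f(\cdot\,;\ell_t)$ (on the cube) at $q_t$, selected as a function of the observed history. **Theorem.** With $P_t=P^{q_t}$ and $\pi_t=\pi^{q_t}$, let $$\hat R^{APP}_{1:T}=\sum_{t=1}^T\Big(\mathcal C\big(\mathbb E[\ell_t(U)\mid P,\pi_t]\big)-\mathcal C\big(\mathbb E[\ell_t(U)\mid P_t,\pi_t]\big)\Big).$$ Then, with probability at least $1-2\delta$ over the trajectories $U_1,\dots,U_T$, UC-O-REPS obtains $$\hat R^{APP}_{1:T}\le 3FL|X|\left(2\sqrt{T\ln\frac L\delta}+3\sqrt{T|A|\ln\frac{T|X||A|}{\delta}}\right).$$ -/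

import Mathlib

open scoped NNReal

noncomputable section

namespace UCOREPS

/-- A decomposition of the state space `X` into consecutive layers `X_0, …, X_L`, the first and the
last of which are singletons: `layer x` is the index `k(x)` of the layer that contains `x`. -/
structure Layering (X : Type*) (L : ℕ) where
  layer : X → ℕ
  layer_le : ∀ x, layer x ≤ L
  first : X
  last : X
  layer_eq_zero_iff : ∀ x, layer x = 0 ↔ x = first
  layer_eq_last_iff : ∀ x, layer x = L ↔ x = last

variable {X A : Type*} [Fintype X] [Fintype A] {L d T : ℕ}

open Classical in
/-- The layer `X_k`, as a finite set of states. -/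
def Layering.states (G : Layering X L) (k : ℕ) : Finset X :=
  Finset.univ.filter fun x => G.layer x = k

/-- `P x a x'` is a transition function: transitions are only possible between consecutive layers,
and `P(· | x, a)` is a probability vector whenever `x` is not the terminal state. -/
structure IsTransition (G : Layering X L) (P : X → A → X → ℝ) : Prop where
  nonneg : ∀ x a x', 0 ≤ P x a x'
  loop_free : ∀ x a x', P x a x' ≠ 0 → G.layer x' = G.layer x + 1
  sum_eq_one : ∀ x a, G.layer x < L → ∑ x', P x a x' = 1

/-- `p x a` is a stationary stochastic policy: `p(· | x)` is a probability vector
at every nonterminal state (no action is taken at the terminal state). -/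
structure IsPolicy (G : Layering X L) (p : X → A → ℝ) : Prop where
  nonneg : ∀ x a, G.layer x < L → 0 ≤ p x a
  sum_eq_one : ∀ x, G.layer x < L → ∑ a, p x a = 1

/-- A loss function with values in `[0,1]^d`. -/
def IsLoss (l : X → A → X → (Fin d → ℝ)) : Prop :=
  ∀ x a x' j, 0 ≤ l x a x' j ∧ l x a x' j ≤ 1

/-- An episodic loop-free adversarial MDP with `T` episodes of `L` steps; `loss t` is the loss
function of the `(t+1)`-st episode. -/
structure AdversarialMDP (X A : Type*) [Fintype X] (L d T : ℕ) where
  layering : Layering X L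
  P : X → A → X → ℝ
  isTransition : IsTransition layering P
  loss : Fin T → X → A → X → (Fin d → ℝ)
  isLoss : ∀ t, IsLoss (loss t)

/-! ### Trajectories, expected losses, occupancy measures -/

/-- A trajectory `x_0, a_0, x_1, …, a_{L-1}, x_L` through the consecutive layers. -/
structure Trajectory (G : Layering X L) (A : Type*) where
  state : Fin (L + 1) → X
  action : Fin L → A
  layer_state : ∀ k, G.layer (state k) = k

open Classical in
instance (G : Layering X L) : Fintype (Trajectory G A) :=
  Fintype.ofInjective (fun U => (U.state, U.action)) (by
    rintro ⟨x, a, h⟩ ⟨x', a', h'⟩ e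
    simp only [Prod.mk.injEq] at e
    obtain ⟨rfl, rfl⟩ := e
    rfl)

/-- The probability that transition function `P` and policy `p` generate the trajectory `U`. -/
def trajProb {G : Layering X L} (P : X → A → X → ℝ) (p : X → A → ℝ) (U : Trajectory G A) : ℝ :=
  ∏ k : Fin L, p (U.state k.castSucc) (U.action k) *
    P (U.state k.castSucc) (U.action k) (U.state k.succ)

/-- `E[l(U) | P, p]`: the sequence, over the steps `k = 0, …, L-1`, of the expectations
of `l(x_k, a_k, x_{k+1})`. -/
def expectedLoss (G : Layering X L) (P : X → A → X → ℝ) (p : X → A → ℝ)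
    (l : X → A → X → (Fin d → ℝ)) : Fin L → (Fin d → ℝ) :=
  fun k => ∑ U : Trajectory G A,
    trajProb P p U • l (U.state k.castSucc) (U.action k) (U.state k.succ)

open Classical in
/-- The occupancy measure `q^{P,p}(x,a,x') = Pr[x_k = x, a_k = a, x_{k+1} = x' | P, p]`
with `k = k(x)` (on trajectories through the layers, `x_k = x` is only possible for `k = k(x)`). -/
def occupancy (G : Layering X L) (P : X → A → X → ℝ) (p : X → A → ℝ) : X → A → X → ℝ :=
  fun x a x' => ∑ U : Trajectory G A,
    if ∃ k : Fin L, U.state k.castSucc = x ∧ U.action k = a ∧ U.state k.succ = x'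
    then trajProb P p U else 0

/-- The transition function `P^q` induced by `q`. -/
def inducedTransition (G : Layering X L) (q : X → A → X → ℝ) : X → A → X → ℝ :=
  fun x a x' => q x a x' / ∑ y ∈ G.states (G.layer x + 1), q x a y

/-- The policy `π^q` induced by `q`. -/
def inducedPolicy (G : Layering X L) (q : X → A → X → ℝ) : X → A → ℝ :=
  fun x a => (∑ x' ∈ G.states (G.layer x + 1), q x a x') /
    ∑ b, ∑ x' ∈ G.states (G.layer x + 1), q x b x'

/-! ### Performance criteria -/

/-- The cube `[0,1]^{X × A × X}`. -/
def cube (X A : Type*) : Set (X → A → X → ℝ) := Set.Icc 0 1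

/-- `f l q = f^C(q; l)` is a criterion function of the performance criterion `C`: it is convex and
nonnegative on the cube, and `C(E[l(U) | P, p]) = f^C(q^{P,p}; l)` for all transition functions `P`
and policies `p`. A criterion is convexly-measurable if it has a criterion function. -/
structure IsCriterionFunction (G : Layering X L) (C : (Fin L → (Fin d → ℝ)) → ℝ≥0)
    (f : (X → A → X → (Fin d → ℝ)) → (X → A → X → ℝ) → ℝ) : Prop where
  convexOn : ∀ l, IsLoss l → ConvexOn ℝ (cube X A) (f l)
  nonneg : ∀ l, IsLoss l → ∀ q ∈ cube X A, 0 ≤ f l q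
  eq_criterion : ∀ l, IsLoss l → ∀ P p, IsTransition G P → IsPolicy G p →
    (C (expectedLoss G P p l) : ℝ) = f l (occupancy G P p)

/-- `g` is `F`-Lipschitz on the cube with respect to the `L_1` norm. -/
def IsLipschitzL1 (F : ℝ) (g : (X → A → X → ℝ) → ℝ) : Prop :=
  ∀ q ∈ cube X A, ∀ q' ∈ cube X A, |g q - g q'| ≤ F * ∑ x, ∑ a, ∑ x', |q x a x' - q' x a x'|

/-- `z ∈ ∂g(q)`, for a function `g` on the cube. -/
def IsSubgradient (g : (X → A → X → ℝ) → ℝ) (q z : X → A → X → ℝ) : Prop :=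
  ∀ q' ∈ cube X A, g q + ∑ x, ∑ a, ∑ x', z x a x' * (q' x a x' - q x a x') ≤ g q'

/-! ### Counters and epochs -/

/-- The counters of the algorithm: `N`, `M` count the visits and the transitions before the
current epoch, `n`, `m` those of the current epoch. -/
structure Counters (X A : Type*) where
  N : X → A → ℕ
  M : X → A → X → ℕ
  n : X → A → ℕ
  m : X → A → X → ℕ

/-- All counters start at zero. -/
def Counters.init : Counters X A := ⟨fun _ _ => 0, fun _ _ _ => 0, fun _ _ => 0, fun _ _ _ => 0⟩

open Classical in
/-- The counters of the current epoch after the trajectory `U` is added to them. -/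
def Counters.record {G : Layering X L} (c : Counters X A) (U : Trajectory G A) : Counters X A where
  N := c.N
  M := c.M
  n := fun x a => c.n x a +
    if ∃ k : Fin L, U.state k.castSucc = x ∧ U.action k = a then 1 else 0
  m := fun x a x' => c.m x a x' +
    if ∃ k : Fin L, U.state k.castSucc = x ∧ U.action k = a ∧ U.state k.succ = x' then 1 else 0

/-- The start of a new epoch: the total counters absorb the epoch counters, which are reset. -/
def Counters.newEpoch (c : Counters X A) : Counters X A where
  N := fun x a => c.N x a + c.n x a
  M := fun x a x' => c.M x a x' + c.m x a x'
  n := fun _ _ => 0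
  m := fun _ _ _ => 0

open Classical in
/-- The update at the end of an episode: the trajectory is recorded, and a new epoch starts if
`n(x,a) ≥ N(x,a)` for some pair `(x,a)` at which an action can be taken. -/
def Counters.update {G : Layering X L} (c : Counters X A) (U : Trajectory G A) : Counters X A :=
  if ∃ x a, G.layer x < L ∧ (c.record U).N x a ≤ (c.record U).n x a
  then (c.record U).newEpoch else c.record U

/-- The counters after the episodes in the list `h` (earliest episode first). -/
def countersAfter {G : Layering X L} (h : List (Trajectory G A)) : Counters X A :=
  h.foldl Counters.update Counters.init

/-- The estimate `P̄` of the transition function in the current epoch. -/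
def Counters.estimate (c : Counters X A) : X → A → X → ℝ :=
  fun x a x' => (c.M x a x' : ℝ) / max 1 (c.N x a : ℝ)

/-- The confidence radius `ε(x,a)` of the current epoch. -/
def Counters.radius (c : Counters X A) (G : Layering X L) (T : ℕ) (δ : ℝ) : X → A → ℝ :=
  fun x a => √(2 * (G.states (G.layer x + 1)).card *
    Real.log (T * Fintype.card X * Fintype.card A / δ) / max 1 (c.N x a : ℝ))

/-- The confidence set `Δ(M,i)` of the current epoch. Elements are functions on the triples of
`X_k × A × X_{k+1}`, extended by zero. The bound on `P^q(· | x,a)` concerns the pairs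
with `q(x,a) ≠ 0`, where `P^q(· | x,a)` is defined. -/
structure InConfidenceSet (G : Layering X L) (T : ℕ) (δ : ℝ) (c : Counters X A)
    (q : X → A → X → ℝ) : Prop where
  mem_cube : q ∈ cube X A
  support : ∀ x a x', G.layer x' ≠ G.layer x + 1 → q x a x' = 0
  sum_eq_one : ∀ k < L, ∑ x ∈ G.states k, ∑ a, ∑ x' ∈ G.states (k + 1), q x a x' = 1
  flow : ∀ x, 0 < G.layer x → G.layer x < L →
    ∑ x' ∈ G.states (G.layer x + 1), ∑ a, q x a x' =
      ∑ x' ∈ G.states (G.layer x - 1), ∑ a, q x' a x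
  close : ∀ x a, G.layer x < L → ∑ x' ∈ G.states (G.layer x + 1), q x a x' ≠ 0 →
    ∑ x' ∈ G.states (G.layer x + 1), |inducedTransition G q x a x' - c.estimate x a x'| ≤
      c.radius G T δ x a

/-! ### The algorithm -/

/-- The unnormalized Kullback-Leibler divergence `D(q || q')`. -/
def klDiv (q q' : X → A → X → ℝ) : ℝ :=
  ∑ x, ∑ a, ∑ x', (q x a x' * Real.log (q x a x' / q' x a x') - q x a x' + q' x a x')

/-- The objective `η ⟨q, z⟩ + D(q || q')` of the mirror descent step. -/
def mirrorObjective (η : ℝ) (z q' q : X → A → X → ℝ) : ℝ :=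
  η * (∑ x, ∑ a, ∑ x', q x a x' * z x a x') + klDiv q q'

open Classical in
/-- The initial occupancy measure, `1 / (|X_k| |A| |X_{k+1}|)` on `X_k × A × X_{k+1}`. -/
def initialOccupancy (G : Layering X L) : X → A → X → ℝ :=
  fun x _ x' => if G.layer x' = G.layer x + 1 then
    1 / ((G.states (G.layer x)).card * Fintype.card A * (G.states (G.layer x + 1)).card) else 0

/-- `q` describes UC-O-REPS with parameters `η`, `δ` and criterion function `f`. Here `q h` is the
occupancy measure which the algorithm chooses after having observed the trajectories in `h`
(earliest first), so it is `q_{t+1}` if `h` has length `t`. It starts from the initial occupancy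
measure; after a further trajectory `U` it takes some subgradient `z` at `q h` of the criterion
function for the current loss, and passes to a minimizer of the mirror descent objective over the
confidence set of the epoch to which the next episode belongs. -/
structure IsUCOREPS (M : AdversarialMDP X A L d T)
    (f : (X → A → X → (Fin d → ℝ)) → (X → A → X → ℝ) → ℝ) (η δ : ℝ)
    (q : List (Trajectory M.layering A) → (X → A → X → ℝ)) : Prop where
  init : q [] = initialOccupancy M.layering
  step : ∀ (h : List (Trajectory M.layering A)) (U : Trajectory M.layering A)
    (ht : h.length < T), ∃ z : X → A → X → ℝ,
      IsSubgradient (f (M.loss ⟨h.length, ht⟩)) (q h) z ∧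
      InConfidenceSet M.layering T δ (countersAfter (h ++ [U])) (q (h ++ [U])) ∧
      ∀ q', InConfidenceSet M.layering T δ (countersAfter (h ++ [U])) q' →
        mirrorObjective η z (q h) (q (h ++ [U])) ≤ mirrorObjective η z (q h) q'

/-- The trajectories observed before episode `t` (counted from zero) in the run `ω`. -/
def history {S : Type*} (ω : Fin T → S) (t : Fin T) : List S :=
  (List.ofFn ω).take t

/-- The probability that the learner which plays `π^{q h}` after history `h` observes the
trajectories `ω 0, …, ω (T-1)` in the `T` episodes. -/
def runProb (M : AdversarialMDP X A L d T)
    (q : List (Trajectory M.layering A) → (X → A → X → ℝ))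
    (ω : Fin T → Trajectory M.layering A) : ℝ :=
  ∏ t, trajProb M.P (inducedPolicy M.layering (q (history ω t))) (ω t)

open Classical in
/-- The probability of an event over the `T` episodes of interaction. -/
def probability (M : AdversarialMDP X A L d T)
    (q : List (Trajectory M.layering A) → (X → A → X → ℝ))
    (E : Set (Fin T → Trajectory M.layering A)) : ℝ :=
  ∑ ω : Fin T → Trajectory M.layering A, if ω ∈ E then runProb M q ω else 0

/-- The approximation part of the regret in the run `ω`: with `q_t` the occupancy
measure chosen for episode `t`, `π_t = π^{q_t}` and `P_t = P^{q_t}`, it is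
`∑_t (C(E[l_t(U) | P, π_t]) - C(E[l_t(U) | P_t, π_t]))`. -/
def approxRegret (M : AdversarialMDP X A L d T) (C : (Fin L → (Fin d → ℝ)) → ℝ≥0)
    (q : List (Trajectory M.layering A) → (X → A → X → ℝ))
    (ω : Fin T → Trajectory M.layering A) : ℝ :=
  ∑ t, ((C (expectedLoss M.layering M.P
          (inducedPolicy M.layering (q (history ω t))) (M.loss t)) : ℝ) -
        (C (expectedLoss M.layering (inducedTransition M.layering (q (history ω t)))
          (inducedPolicy M.layering (q (history ω t))) (M.loss t)) : ℝ))

end UCOREPS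

end

namespace UCOREPS

/-! ### Concentration over finite probability spaces -/

/-- **Hoeffding's lemma** for a finite probability vector. -/
theorem sum_mul_exp_le {ι : Type*} [Fintype ι] {p z : ι → ℝ} {a b : ℝ} (hp : ∀ i, 0 ≤ p i)
    (hp1 : ∑ i, p i = 1) (hz : ∀ i, z i ∈ Set.Icc a b) (r : ℝ) :
    ∑ i, p i * Real.exp (r * (z i - ∑ j, p j * z j)) ≤ Real.exp (r ^ 2 * (b - a) ^ 2 / 8) := by
  let _ : MeasurableSpace ι := ⊤
  have hs : ∑ i, ENNReal.ofReal (p i) = 1 := by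
    rw [← ENNReal.ofReal_sum_of_nonneg fun i _ => hp i, hp1, ENNReal.ofReal_one]
  let μ := (PMF.ofFintype (fun i => ENNReal.ofReal (p i)) hs).toMeasure
  have hint : ∀ g : ι → ℝ, ∫ i, g i ∂μ = ∑ i, p i * g i := fun g => by
    rw [PMF.integral_eq_sum]
    exact Finset.sum_congr rfl fun i _ => by
      simp [PMF.ofFintype_apply, ENNReal.toReal_ofReal (hp i)]
  have h := (ProbabilityTheory.hasSubgaussianMGF_of_mem_Icc (μ := μ) (X := z) (a := a) (b := b)
    (measurable_from_top.aemeasurable) (Filter.Eventually.of_forall hz)).mgf_le r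
  rw [ProbabilityTheory.mgf, hint, hint] at h
  refine h.trans (le_of_eq ?_)
  congr 1
  simp only [NNReal.coe_pow, NNReal.coe_div, coe_nnnorm, NNReal.coe_ofNat, Real.norm_eq_abs,
    div_pow, sq_abs]
  ring

theorem history_zero {S : Type*} {T : ℕ} (s : S) (ω : Fin T → S) :
    history (Fin.cons s ω : Fin (T + 1) → S) 0 = [] := by
  simp [history]

theorem history_succ {S : Type*} {T : ℕ} (s : S) (ω : Fin T → S) (t : Fin T) :
    history (Fin.cons s ω : Fin (T + 1) → S) t.succ = s :: history ω t := by
  simp [history, List.ofFn_succ]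

theorem length_history {S : Type*} {T : ℕ} (ω : Fin T → S) (t : Fin T) :
    (history ω t).length = t := by
  simp [history, t.isLt.le]

theorem history_append {S : Type*} {T : ℕ} (ω : Fin T → S) (t : Fin T) :
    history ω t ++ [ω t] = (List.ofFn ω).take (t + 1) := by
  rw [history, List.take_add_one]
  simp

theorem sum_cons_eq {S : Type*} [Fintype S] {T : ℕ} (g : (Fin (T + 1) → S) → ℝ) :
    ∑ ω, g ω = ∑ s, ∑ ω : Fin T → S, g (Fin.cons s ω) := by
  rw [← Fintype.sum_prod_type']
  exact (Equiv.sum_comp (Fin.consEquiv fun _ : Fin (T + 1) => S) g).symm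

theorem sum_prod_append_cons {S : Type*} [Fintype S] {T : ℕ} (p : List S → S → ℝ)
    (h : List S) :
    ∑ ω : Fin (T + 1) → S, ∏ t, p (h ++ history ω t) (ω t) =
      ∑ s, p h s * ∑ ω : Fin T → S, ∏ t, p ((h ++ [s]) ++ history ω t) (ω t) := by
  rw [sum_cons_eq]
  refine Finset.sum_congr rfl fun s _ => ?_
  rw [Finset.mul_sum]
  refine Finset.sum_congr rfl fun ω _ => ?_
  rw [Fin.prod_univ_succ]
  simp [history_zero, history_succ]

/-- If the weights of the possible continuations of every history sum to at most one, then so do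
the weights of the runs. -/
theorem sum_prod_history_le_one {S : Type*} [Fintype S] {T : ℕ} {p : List S → S → ℝ}
    (hp : ∀ h, h.length < T → ∀ s, 0 ≤ p h s) (hp1 : ∀ h, h.length < T → ∑ s, p h s ≤ 1) :
    ∑ ω : Fin T → S, ∏ t, p (history ω t) (ω t) ≤ 1 := by
  suffices H : ∀ n (h : List S), h.length + n ≤ T →
      ∑ ω : Fin n → S, ∏ t, p (h ++ history ω t) (ω t) ≤ 1 by
    simpa using H T [] (by simp)
  intro n
  induction n with
  | zero => intro h _; simp
  | succ n ih =>
    intro h hn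
    rw [sum_prod_append_cons]
    refine le_trans (Finset.sum_le_sum fun s _ => ?_) (hp1 h (by omega))
    exact mul_le_of_le_one_right (hp h (by omega) s) (ih _ (by simp; omega))

theorem sum_prod_history_eq_one {S : Type*} [Fintype S] {T : ℕ} {p : List S → S → ℝ}
    (hp1 : ∀ h, h.length < T → ∑ s, p h s = 1) :
    ∑ ω : Fin T → S, ∏ t, p (history ω t) (ω t) = 1 := by
  suffices H : ∀ n (h : List S), h.length + n ≤ T →
      ∑ ω : Fin n → S, ∏ t, p (h ++ history ω t) (ω t) = 1 by
    simpa using H T [] (by simp)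
  intro n
  induction n with
  | zero => intro h _; simp
  | succ n ih =>
    intro h hn
    rw [sum_prod_append_cons, ← hp1 h (by omega)]
    refine Finset.sum_congr rfl fun s _ => ?_
    rw [ih _ (by simp; omega), mul_one]

open Classical in
/-- Markov's inequality for an exponential supermartingale. -/
theorem sum_ite_le_exp_neg {S : Type*} [Fintype S] {T : ℕ} {p w : List S → S → ℝ}
    (hp : ∀ h, h.length < T → ∀ s, 0 ≤ p h s)
    (hw : ∀ h, h.length < T → ∑ s, p h s * Real.exp (w h s) ≤ 1) (c : ℝ) :
    (∑ ω : Fin T → S, if c ≤ ∑ t, w (history ω t) (ω t)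
      then ∏ t, p (history ω t) (ω t) else 0) ≤ Real.exp (-c) := by
  have hlen : ∀ (ω : Fin T → S) (t : Fin T), (history ω t).length < T := fun ω t => by
    rw [length_history]; exact t.isLt
  have key := sum_prod_history_le_one (p := fun h s => p h s * Real.exp (w h s))
    (fun h hh s => mul_nonneg (hp h hh s) (Real.exp_pos _).le) hw
  calc _ ≤ ∑ ω : Fin T → S, Real.exp (-c) *
        ∏ t, p (history ω t) (ω t) * Real.exp (w (history ω t) (ω t)) := by
        refine Finset.sum_le_sum fun ω _ => ?_
        have h0 : 0 ≤ ∏ t, p (history ω t) (ω t) :=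
          Finset.prod_nonneg fun t _ => hp _ (hlen ω t) _
        rw [Finset.prod_mul_distrib, ← Real.exp_sum]
        split_ifs with hc
        · rw [mul_left_comm, ← Real.exp_add]
          exact le_mul_of_one_le_right h0 (Real.one_le_exp (by linarith))
        · positivity
    _ ≤ _ := by
        rw [← Finset.mul_sum]
        exact mul_le_of_le_one_right (Real.exp_pos _).le key

/-- A step of the estimate of `∑ 1 / √N` over epochs which at most double the count. -/
theorem sqrt_add_div_sqrt_le {N n : ℝ} (hN : 0 ≤ N) (hn : 0 ≤ n) (hnN : n ≤ max 1 N)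
    (hN1 : N = 0 ∨ 1 ≤ N) (hn1 : n = 0 ∨ 1 ≤ n) :
    5 / 2 * √N + n / √(max 1 N) ≤ 5 / 2 * √(N + n) := by
  rcases hN1 with rfl | h1
  · rw [max_eq_left zero_le_one] at *
    rcases hn1 with rfl | h2
    · simp
    · obtain rfl : n = 1 := le_antisymm hnN h2
      norm_num
  · rw [max_eq_right h1] at *
    have hpos : 0 < √N := Real.sqrt_pos.2 (by linarith)
    have e1 := Real.sq_sqrt hN
    have e2 := Real.sq_sqrt (add_nonneg hN hn)
    have h3 : √(N + n) ≤ 3 / 2 * √N := by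
      rw [Real.sqrt_le_left (by positivity), mul_pow, e1]; linarith
    rw [← le_sub_iff_add_le', div_le_iff₀ hpos]
    have h4 : √N ≤ √(N + n) := Real.sqrt_le_sqrt (by linarith)
    nlinarith [mul_nonneg (sub_nonneg.2 h4) (sub_nonneg.2 h3)]

end UCOREPS

set_option linter.unusedSectionVars false

noncomputable section

namespace UCOREPS

variable {X A : Type*} [Fintype X] [Fintype A] {L d T : ℕ}

section

/-! ### Marginals of the trajectory distribution -/

/-- The mass which the initial weights `v` and the step weights `W` transport to each state
in `k` steps. -/
def pathMass (v : X → ℝ) (W : ℕ → X → A → X → ℝ) : ℕ → X → ℝ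
  | 0 => v
  | k + 1 => fun x' => ∑ x, ∑ a, pathMass v W k x * W k x a x'

theorem sum_snoc_eq {S : Type*} [Fintype S] {n : ℕ} (g : (Fin (n + 1) → S) → ℝ) :
    ∑ s, g s = ∑ s : Fin n → S, ∑ y, g (Fin.snoc s y : Fin (n + 1) → S) := by
  rw [Finset.sum_comm, ← Fintype.sum_prod_type']
  exact (Equiv.sum_comp (Fin.snocEquiv fun _ : Fin (n + 1) => S) g).symm

theorem sum_path_eq (v : X → ℝ) (W : ℕ → X → A → X → ℝ) (n : ℕ) (u : X → ℝ) :
    ∑ s : Fin (n + 1) → X, ∑ a : Fin n → A,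
      v (s 0) * (∏ k : Fin n, W k (s k.castSucc) (a k) (s k.succ)) * u (s (Fin.last n)) =
    ∑ x, pathMass v W n x * u x := by
  induction n generalizing u with
  | zero =>
    rw [sum_cons_eq]
    simp [pathMass]
  | succ n ih =>
    rw [sum_snoc_eq]
    simp_rw [sum_snoc_eq (S := A)]
    have h : ∀ (s : Fin (n + 1) → X) (x' : X) (a : Fin n → A) (b : A),
        v ((Fin.snoc s x' : Fin (n + 2) → X) 0) *
          (∏ k : Fin (n + 1), W k ((Fin.snoc s x' : Fin (n + 2) → X) k.castSucc)
            ((Fin.snoc a b : Fin (n + 1) → A) k) ((Fin.snoc s x' : Fin (n + 2) → X) k.succ)) *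
          u ((Fin.snoc s x' : Fin (n + 2) → X) (Fin.last (n + 1))) =
        v (s 0) * (∏ k : Fin n, W k (s k.castSucc) (a k) (s k.succ)) *
          (W n (s (Fin.last n)) b x' * u x') := by
      intro s x' a b
      rw [Fin.prod_univ_castSucc]
      have e0 : (Fin.snoc s x' : Fin (n + 2) → X) 0 = s 0 := by
        rw [← Fin.castSucc_zero, Fin.snoc_castSucc]
      have e1 : ∀ k : Fin n, (Fin.snoc s x' : Fin (n + 2) → X) k.castSucc.succ = s k.succ := by
        intro k
        rw [Fin.succ_castSucc, Fin.snoc_castSucc]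
      simp only [e0, e1, Fin.snoc_castSucc, Fin.snoc_last, Fin.succ_last, Fin.val_castSucc,
        Fin.val_last]
      ring
    simp_rw [h]
    have h2 : ∀ s : Fin (n + 1) → X,
        ∑ x', ∑ a : Fin n → A, ∑ b, v (s 0) *
          (∏ k : Fin n, W k (s k.castSucc) (a k) (s k.succ)) *
          (W n (s (Fin.last n)) b x' * u x') =
        ∑ a : Fin n → A, v (s 0) * (∏ k : Fin n, W k (s k.castSucc) (a k) (s k.succ)) *
          ∑ x', ∑ b, W n (s (Fin.last n)) b x' * u x' := by
      intro s
      rw [Finset.sum_comm]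
      simp_rw [Finset.mul_sum]
    simp_rw [h2]
    rw [ih fun x => ∑ x', ∑ b, W n x b x' * u x']
    simp_rw [pathMass, Finset.mul_sum, Finset.sum_mul]
    rw [Finset.sum_comm]
    simp_rw [mul_assoc]

open Classical in
/-- The point mass at the initial state. -/
def initialMass (G : Layering X L) : X → ℝ := fun x => if x = G.first then 1 else 0

/-- The distribution of the state in the `k`-th step. -/
def stateDist (G : Layering X L) (P : X → A → X → ℝ) (p : X → A → ℝ) : ℕ → X → ℝ :=
  pathMass (initialMass G) fun _ x a x' => p x a * P x a x'

variable {G : Layering X L} {P P' : X → A → X → ℝ} {p : X → A → ℝ}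

theorem pathMass_eq_zero (hP : IsTransition G P) (g : ℕ → X → A → X → ℝ) (k : ℕ) (x : X)
    (hx : G.layer x ≠ k) :
    pathMass (initialMass G) (fun k x a x' => p x a * P x a x' * g k x a x') k x = 0 := by
  induction k generalizing x with
  | zero =>
    rw [Ne, G.layer_eq_zero_iff] at hx
    simp [pathMass, initialMass, hx]
  | succ k ih =>
    refine Finset.sum_eq_zero fun y _ => Finset.sum_eq_zero fun a _ => ?_
    by_cases hy : G.layer y = k
    · have : P y a x = 0 := by
        by_contra h
        exact hx (by rw [hP.loop_free y a x h, hy])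
      simp [this]
    · rw [ih y hy, zero_mul]

theorem Trajectory.state_zero (U : Trajectory G A) : U.state 0 = G.first :=
  (G.layer_eq_zero_iff _).1 (by simpa using U.layer_state 0)

theorem sum_trajProb_mul_prod (hP : IsTransition G P) (g : ℕ → X → A → X → ℝ) :
    ∑ U : Trajectory G A, trajProb P p U *
      ∏ k : Fin L, g k (U.state k.castSucc) (U.action k) (U.state k.succ) =
    ∑ x, pathMass (initialMass G) (fun k x a x' => p x a * P x a x' * g k x a x') L x := by
  have h := sum_path_eq (initialMass G) (fun k x a x' => p x a * P x a x' * g k x a x') L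
    fun _ => (1 : ℝ)
  simp only [mul_one] at h
  rw [← h, ← Fintype.sum_prod_type']
  refine Fintype.sum_of_injective (fun U : Trajectory G A => (U.state, U.action)) ?_ _ _ ?_ ?_
  · rintro ⟨x, a, h⟩ ⟨x', a', h'⟩ e
    simp only [Prod.mk.injEq] at e
    obtain ⟨rfl, rfl⟩ := e
    rfl
  · rintro ⟨s, a⟩ hsa
    by_contra hne
    refine hsa ⟨⟨s, a, ?_⟩, rfl⟩
    have h0 : s 0 = G.first := by
      by_contra h
      exact hne (by simp [initialMass, h])
    have hk : ∀ k : Fin L, P (s k.castSucc) (a k) (s k.succ) ≠ 0 := fun k hk =>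
      hne (mul_eq_zero_of_right _ (Finset.prod_eq_zero (Finset.mem_univ k) (by simp [hk])))
    intro k
    induction k using Fin.induction with
    | zero => simpa using (G.layer_eq_zero_iff _).2 h0
    | succ k ih => rw [hP.loop_free _ _ _ (hk k), ih]; simp
  · intro U
    simp only [trajProb, ← Finset.prod_mul_distrib, U.state_zero, initialMass, if_true, one_mul]

theorem stateDist_eq_zero (hP : IsTransition G P) {k : ℕ} {x : X} (hx : G.layer x ≠ k) :
    stateDist G P p k x = 0 := by
  simpa [stateDist] using pathMass_eq_zero (p := p) hP (fun _ _ _ _ => 1) k x hx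

theorem stateDist_succ (k : ℕ) (x' : X) :
    stateDist G P p (k + 1) x' = ∑ x, ∑ a, stateDist G P p k x * (p x a * P x a x') := rfl

theorem stateDist_nonneg (hP : IsTransition G P) (hp : IsPolicy G p) {k : ℕ} (hk : k ≤ L)
    (x : X) : 0 ≤ stateDist G P p k x := by
  induction k generalizing x with
  | zero => simp only [stateDist, pathMass, initialMass]; split_ifs <;> norm_num
  | succ k ih =>
    rw [stateDist_succ]
    refine Finset.sum_nonneg fun y _ => Finset.sum_nonneg fun a _ => ?_
    by_cases hy : G.layer y = k
    · exact mul_nonneg (ih (by omega) y)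
        (mul_nonneg (hp.nonneg y a (by omega)) (hP.nonneg y a x))
    · rw [stateDist_eq_zero hP hy, zero_mul]

/-- A further step preserves the mass. -/
theorem sum_sum_step (hP : IsTransition G P) (hp : IsPolicy G p) {k : ℕ} (hk : k < L)
    {m : X → ℝ} (hm : ∀ x, G.layer x ≠ k → m x = 0) :
    ∑ x', ∑ x, ∑ a, m x * (p x a * P x a x') = ∑ x, m x := by
  rw [Finset.sum_comm]
  refine Finset.sum_congr rfl fun x _ => ?_
  by_cases hx : G.layer x = k
  · rw [Finset.sum_comm]
    simp_rw [← Finset.mul_sum, hP.sum_eq_one x _ (hx ▸ hk), mul_one, hp.sum_eq_one x (hx ▸ hk),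
      mul_one]
  · simp [hm x hx]

theorem sum_stateDist (hP : IsTransition G P) (hp : IsPolicy G p) {k : ℕ} (hk : k ≤ L) :
    ∑ x, stateDist G P p k x = 1 := by
  induction k with
  | zero =>
    classical
    exact (Finset.sum_ite_eq' Finset.univ G.first fun _ => (1 : ℝ)).trans (by simp)
  | succ k ih =>
    simp_rw [stateDist_succ]
    rw [sum_sum_step hP hp hk fun x => stateDist_eq_zero hP, ih (by omega)]

theorem sum_trajProb (hP : IsTransition G P) (hp : IsPolicy G p) :
    ∑ U : Trajectory G A, trajProb P p U = 1 := by
  have h := sum_trajProb_mul_prod (p := p) hP fun _ _ _ _ => 1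
  simp only [Finset.prod_const_one, mul_one] at h
  rw [h]
  exact sum_stateDist hP hp le_rfl

theorem trajProb_nonneg (hP : IsTransition G P) (hp : IsPolicy G p) (U : Trajectory G A) :
    0 ≤ trajProb P p U :=
  Finset.prod_nonneg fun k _ => mul_nonneg
    (hp.nonneg _ _ (by rw [U.layer_state]; simp)) (hP.nonneg _ _ _)

/-- The distribution of the `k`-th step of a trajectory. -/
theorem sum_trajProb_mul (hP : IsTransition G P) (hp : IsPolicy G p) (k : Fin L)
    (g : X → A → X → ℝ) :
    ∑ U : Trajectory G A, trajProb P p U * g (U.state k.castSucc) (U.action k) (U.state k.succ) =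
      ∑ x, ∑ a, ∑ x', stateDist G P p k x * (p x a * P x a x') * g x a x' := by
  set g' : ℕ → X → A → X → ℝ := fun j x a x' => if j = k then g x a x' else 1 with hg'
  have h := sum_trajProb_mul_prod (p := p) hP g'
  have e : ∀ U : Trajectory G A,
      ∏ j : Fin L, g' j (U.state j.castSucc) (U.action j) (U.state j.succ) =
        g (U.state k.castSucc) (U.action k) (U.state k.succ) := by
    intro U
    rw [Finset.prod_eq_single k]
    · simp [hg']
    · intro j _ hj
      simp [hg', Fin.val_inj, hj]
    · simp
  simp_rw [e] at h
  rw [h]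
  set W : ℕ → X → A → X → ℝ := fun k x a x' => p x a * P x a x' * g' k x a x' with hW
  have before : ∀ j ≤ (k : ℕ), pathMass (initialMass G) W j = stateDist G P p j := by
    intro j hj
    induction j with
    | zero => rfl
    | succ j ih =>
      funext x'
      rw [stateDist_succ, ← ih (by omega)]
      have : j ≠ k := by omega
      simp [pathMass, hW, hg', this]
  have after : ∀ j, (k : ℕ) + 1 + j ≤ L → ∑ x, pathMass (initialMass G) W (k + 1 + j) x =
      ∑ x, pathMass (initialMass G) W (k + 1) x := by
    intro j hj
    induction j with
    | zero => rfl
    | succ j ih =>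
      rw [← ih (by omega), ← sum_sum_step (m := pathMass (initialMass G) W (k + 1 + j))
        (k := k + 1 + j) hP hp (by omega) fun x hx => pathMass_eq_zero hP g' _ x hx, ← add_assoc]
      have : (k : ℕ) + 1 + j ≠ k := by omega
      simp [pathMass, hW, hg', this]
  have hkL := k.isLt
  have h3 := after (L - (k + 1)) (by omega)
  rw [show (k : ℕ) + 1 + (L - (k + 1)) = L by omega] at h3
  rw [h3]
  simp only [pathMass, before k le_rfl]
  rw [Finset.sum_comm]
  refine Finset.sum_congr rfl fun x _ => ?_
  rw [Finset.sum_comm]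
  simp [hW, hg', mul_assoc]

theorem Trajectory.layer_castSucc (U : Trajectory G A) (k : Fin L) :
    G.layer (U.state k.castSucc) = k := by simp [U.layer_state]

theorem Trajectory.eq_of_state_eq (U : Trajectory G A) {k : Fin L} {x : X}
    (h : U.state k.castSucc = x) (hx : G.layer x < L) : k = ⟨G.layer x, hx⟩ := by
  subst h; ext; simp [U.layer_castSucc]

theorem occupancy_eq (hP : IsTransition G P) (hp : IsPolicy G p) (x : X) (a : A) (x' : X) :
    occupancy G P p x a x' =
      if G.layer x < L then stateDist G P p (G.layer x) x * (p x a * P x a x') else 0 := by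
  classical
  split_ifs with hx
  · have h := sum_trajProb_mul hP hp ⟨G.layer x, hx⟩
      fun y b y' => if y = x ∧ b = a ∧ y' = x' then 1 else 0
    have e : ∀ U : Trajectory G A, (if ∃ k : Fin L, U.state k.castSucc = x ∧ U.action k = a ∧
        U.state k.succ = x' then trajProb P p U else 0) = trajProb P p U *
        if U.state (⟨G.layer x, hx⟩ : Fin L).castSucc = x ∧ U.action ⟨G.layer x, hx⟩ = a ∧
          U.state (⟨G.layer x, hx⟩ : Fin L).succ = x' then 1 else 0 := by
      intro U
      rw [mul_ite, mul_one, mul_zero]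
      refine if_congr ⟨?_, fun h => ⟨_, h⟩⟩ rfl rfl
      rintro ⟨k, h1, h2⟩
      obtain rfl := U.eq_of_state_eq h1 hx
      exact ⟨h1, h2⟩
    simp only [occupancy]
    simp_rw [e]
    rw [h]
    rw [Finset.sum_eq_single x, Finset.sum_eq_single a, Finset.sum_eq_single x']
    · simp
    · intro b _ hb; simp [hb]
    · simp
    · intro b _ hb; simp [hb]
    · simp
    · intro b _ hb; simp [hb]
    · simp
  · refine Finset.sum_eq_zero fun U _ => if_neg ?_
    rintro ⟨k, h1, -⟩
    exact hx (by rw [← h1, U.layer_castSucc]; exact k.isLt)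

theorem sum_occupancy (hP : IsTransition G P) (hp : IsPolicy G p) {x : X} (hx : G.layer x < L) :
    ∑ a, ∑ x', occupancy G P p x a x' = stateDist G P p (G.layer x) x := by
  simp_rw [occupancy_eq hP hp, if_pos hx, ← Finset.mul_sum, hP.sum_eq_one x _ hx, mul_one,
    hp.sum_eq_one x hx, mul_one]

/-! ### Occupancy measures of close transition functions -/

/-- The expected distance of `P` and `P'` in the `k`-th step, under `P`. -/
def stepError (G : Layering X L) (P P' : X → A → X → ℝ) (p : X → A → ℝ) (k : ℕ) : ℝ :=
  ∑ x, ∑ a, stateDist G P p k x * p x a * ∑ x', |P x a x' - P' x a x'|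

theorem sum_abs_step_le (hP : IsTransition G P) (hP' : IsTransition G P') (hp : IsPolicy G p)
    {k : ℕ} (hk : k < L) :
    ∑ x, ∑ a, ∑ x', |stateDist G P p k x * (p x a * P x a x') -
        stateDist G P' p k x * (p x a * P' x a x')| ≤
      ∑ x, |stateDist G P p k x - stateDist G P' p k x| + stepError G P P' p k := by
  rw [stepError, ← Finset.sum_add_distrib]
  refine Finset.sum_le_sum fun x _ => ?_
  by_cases hx : G.layer x = k
  · have hpn : ∀ a, 0 ≤ p x a := fun a => hp.nonneg x a (hx ▸ hk)
    have hm := stateDist_nonneg hP hp hk.le x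
    have e : |stateDist G P p k x - stateDist G P' p k x| =
        ∑ a, ∑ x', |stateDist G P p k x - stateDist G P' p k x| * (p x a * P' x a x') := by
      simp_rw [← Finset.mul_sum, hP'.sum_eq_one x _ (hx ▸ hk), mul_one,
        hp.sum_eq_one x (hx ▸ hk), mul_one]
    rw [e, ← Finset.sum_add_distrib]
    refine Finset.sum_le_sum fun a _ => ?_
    rw [Finset.mul_sum, ← Finset.sum_add_distrib]
    refine Finset.sum_le_sum fun x' _ => ?_
    have e2 : stateDist G P p k x * (p x a * P x a x') -
        stateDist G P' p k x * (p x a * P' x a x') =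
        (stateDist G P p k x - stateDist G P' p k x) * (p x a * P' x a x') +
        stateDist G P p k x * p x a * (P x a x' - P' x a x') := by ring
    rw [e2]
    refine (abs_add_le _ _).trans_eq ?_
    rw [abs_mul, abs_mul (_ * p x a), abs_of_nonneg (mul_nonneg (hpn a) (hP'.nonneg x a x')),
      abs_of_nonneg (mul_nonneg hm (hpn a))]
  · simp [stateDist_eq_zero hP hx, stateDist_eq_zero hP' hx]

theorem stepError_nonneg (hP : IsTransition G P) (hp : IsPolicy G p) {k : ℕ} (hk : k < L) :
    0 ≤ stepError G P P' p k := by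
  refine Finset.sum_nonneg fun x _ => Finset.sum_nonneg fun a _ => ?_
  by_cases hx : G.layer x = k
  · exact mul_nonneg (mul_nonneg (stateDist_nonneg hP hp hk.le x) (hp.nonneg x a (hx ▸ hk)))
      (Finset.sum_nonneg fun _ _ => abs_nonneg _)
  · simp [stateDist_eq_zero hP hx]

theorem sum_abs_stateDist_le (hP : IsTransition G P) (hP' : IsTransition G P')
    (hp : IsPolicy G p) {k : ℕ} (hk : k ≤ L) :
    ∑ x, |stateDist G P p k x - stateDist G P' p k x| ≤
      ∑ j ∈ Finset.range k, stepError G P P' p j := by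
  induction k with
  | zero => simp [stateDist, pathMass]
  | succ k ih =>
    rw [Finset.sum_range_succ]
    refine le_trans ?_ ((sum_abs_step_le hP hP' hp hk).trans (add_le_add_left (ih (by omega)) _))
    calc _ ≤ ∑ x', ∑ x, ∑ a, |stateDist G P p k x * (p x a * P x a x') -
          stateDist G P' p k x * (p x a * P' x a x')| := by
          refine Finset.sum_le_sum fun x' _ => ?_
          simp_rw [stateDist_succ, ← Finset.sum_sub_distrib]
          refine (Finset.abs_sum_le_sum_abs _ _).trans (Finset.sum_le_sum fun x _ => ?_)
          exact Finset.abs_sum_le_sum_abs _ _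
      _ = _ := by
          rw [Finset.sum_comm]
          exact Finset.sum_congr rfl fun x _ => Finset.sum_comm

theorem sum_layer_eq (G : Layering X L) (g : ℕ → X → ℝ) (hg : ∀ k x, G.layer x ≠ k → g k x = 0) :
    ∑ x, (if G.layer x < L then g (G.layer x) x else 0) =
      ∑ k ∈ Finset.range L, ∑ x, g k x := by
  rw [Finset.sum_comm]
  refine Finset.sum_congr rfl fun x _ => ?_
  split_ifs with hx
  · rw [Finset.sum_eq_single (G.layer x)]
    · intro k _ hk; exact hg k x hk.symm
    · simp [hx]
  · refine (Finset.sum_eq_zero fun k hk => hg k x ?_).symm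
    rintro rfl
    exact hx (Finset.mem_range.1 hk)

/-- Simulation lemma: the distance of two occupancy measures of the same policy. -/
theorem sum_abs_occupancy_le (hP : IsTransition G P) (hP' : IsTransition G P')
    (hp : IsPolicy G p) :
    ∑ x, ∑ a, ∑ x', |occupancy G P p x a x' - occupancy G P' p x a x'| ≤
      L * ∑ k ∈ Finset.range L, stepError G P P' p k := by
  have e : ∀ x, ∑ a, ∑ x', |occupancy G P p x a x' - occupancy G P' p x a x'| =
      if G.layer x < L then ∑ a, ∑ x', |stateDist G P p (G.layer x) x * (p x a * P x a x') -
        stateDist G P' p (G.layer x) x * (p x a * P' x a x')| else 0 := by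
    intro x
    simp_rw [occupancy_eq hP hp, occupancy_eq hP' hp]
    split_ifs <;> simp
  simp_rw [e]
  rw [sum_layer_eq G (fun k x => ∑ a, ∑ x', |stateDist G P p k x * (p x a * P x a x') -
        stateDist G P' p k x * (p x a * P' x a x')|)
      (fun k x hx => by simp [stateDist_eq_zero hP hx, stateDist_eq_zero hP' hx])]
  refine (Finset.sum_le_card_nsmul _ _ _ fun k hk => ?_).trans_eq
    (by rw [Finset.card_range, nsmul_eq_mul])
  have hk' := Finset.mem_range.1 hk
  refine (sum_abs_step_le hP hP' hp hk').trans ?_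
  refine (add_le_add_left (sum_abs_stateDist_le hP hP' hp hk'.le) _).trans ?_
  rw [← Finset.sum_range_succ]
  exact Finset.sum_le_sum_of_subset_of_nonneg
    (Finset.range_subset_range.2 hk') fun j hj _ => stepError_nonneg hP hp (Finset.mem_range.1 hj)

theorem sum_stepError (hP : IsTransition G P) (hp : IsPolicy G p) :
    ∑ k ∈ Finset.range L, stepError G P P' p k =
      ∑ U : Trajectory G A, trajProb P p U *
        ∑ k : Fin L, ∑ x', |P (U.state k.castSucc) (U.action k) x' -
          P' (U.state k.castSucc) (U.action k) x'| := by
  simp_rw [Finset.mul_sum (Finset.univ : Finset (Fin L))]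
  rw [Finset.sum_comm, Finset.sum_range]
  refine Finset.sum_congr rfl fun k _ => ?_
  rw [sum_trajProb_mul hP hp k fun x a _ => ∑ x', |P x a x' - P' x a x'|, stepError]
  refine Finset.sum_congr rfl fun x _ => Finset.sum_congr rfl fun a _ => ?_
  rw [← Finset.sum_mul]
  by_cases hx : G.layer x = k
  · simp_rw [← Finset.mul_sum, hP.sum_eq_one x a (hx ▸ k.isLt), mul_one]
  · simp [stateDist_eq_zero hP hx]

end

section

/-! ### Induced transition functions and policies -/

theorem Layering.mem_states {G : Layering X L} {k : ℕ} {x : X} :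
    x ∈ G.states k ↔ G.layer x = k := by
  simp [Layering.states]

theorem Layering.sum_states_eq (G : Layering X L) {k : ℕ} {g : X → ℝ}
    (hg : ∀ x, G.layer x ≠ k → g x = 0) : ∑ x ∈ G.states k, g x = ∑ x, g x := by
  refine Finset.sum_subset (Finset.subset_univ _) fun x _ hx => hg x ?_
  rwa [Layering.mem_states] at hx

theorem IsTransition.states_nonempty [Nonempty A] {G : Layering X L} {P : X → A → X → ℝ}
    (hP : IsTransition G P) {k : ℕ} (hk : k ≤ L) : (G.states k).Nonempty := by
  induction k with
  | zero => exact ⟨G.first, Layering.mem_states.2 ((G.layer_eq_zero_iff _).2 rfl)⟩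
  | succ k ih =>
    obtain ⟨x, hx⟩ := ih (by omega)
    rw [Layering.mem_states] at hx
    have h1 := hP.sum_eq_one x (Classical.arbitrary A) (by omega)
    obtain ⟨x', -, hx'⟩ := Finset.exists_ne_zero_of_sum_ne_zero (by rw [h1]; exact one_ne_zero)
    exact ⟨x', Layering.mem_states.2 (by rw [hP.loop_free _ _ _ hx', hx])⟩

/-- `q` is positive on the triples of `X_k × A × X_{k+1}`, and vanishes elsewhere. -/
structure IsPositive (G : Layering X L) (q : X → A → X → ℝ) : Prop where
  pos : ∀ x a x', G.layer x' = G.layer x + 1 → 0 < q x a x'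
  support : ∀ x a x', G.layer x' ≠ G.layer x + 1 → q x a x' = 0

variable {G : Layering X L} {P : X → A → X → ℝ} {p : X → A → ℝ} {q q' : X → A → X → ℝ}

theorem IsPositive.nonneg (hq : IsPositive G q) (x : X) (a : A) (x' : X) : 0 ≤ q x a x' := by
  by_cases h : G.layer x' = G.layer x + 1
  · exact (hq.pos x a x' h).le
  · exact (hq.support x a x' h).ge

theorem IsPositive.sum_pos [Nonempty A] (hP : IsTransition G P) (hq : IsPositive G q) {x : X}
    (hx : G.layer x < L) (a : A) : 0 < ∑ y ∈ G.states (G.layer x + 1), q x a y :=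
  Finset.sum_pos (fun y hy => hq.pos x a y (Layering.mem_states.1 hy)) (hP.states_nonempty hx)

theorem IsPositive.isTransition [Nonempty A] (hP : IsTransition G P) (hq : IsPositive G q) :
    IsTransition G (inducedTransition G q) where
  nonneg x a x' := div_nonneg (hq.nonneg x a x') (Finset.sum_nonneg fun y _ => hq.nonneg x a y)
  loop_free x a x' h := by
    by_contra h'
    exact h (by rw [inducedTransition, hq.support x a x' h', zero_div])
  sum_eq_one x a hx := by
    simp_rw [inducedTransition]
    rw [← Finset.sum_div, ← G.sum_states_eq fun y hy => hq.support x a y hy]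
    exact div_self (hq.sum_pos hP hx a).ne'

theorem IsPositive.isPolicy [Nonempty A] (hP : IsTransition G P) (hq : IsPositive G q) :
    IsPolicy G (inducedPolicy G q) where
  nonneg x a _ := div_nonneg (Finset.sum_nonneg fun y _ => hq.nonneg x a y)
    (Finset.sum_nonneg fun b _ => Finset.sum_nonneg fun y _ => hq.nonneg x b y)
  sum_eq_one x hx := by
    simp_rw [inducedPolicy]
    rw [← Finset.sum_div]
    exact div_self (Finset.sum_pos (fun b _ => hq.sum_pos hP hx b) Finset.univ_nonempty).ne'

theorem isPositive_initialOccupancy [Nonempty A] (hP : IsTransition G P) :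
    IsPositive G (initialOccupancy G : X → A → X → ℝ) where
  pos x a x' h := by
    rw [initialOccupancy, if_pos h]
    have h0 : 0 < (G.states (G.layer x)).card :=
      Finset.card_pos.2 (hP.states_nonempty (G.layer_le x))
    have h1 : 0 < (G.states (G.layer x + 1)).card :=
      Finset.card_pos.2 (hP.states_nonempty (h ▸ G.layer_le x'))
    have h2 : 0 < Fintype.card A := Fintype.card_pos
    positivity
  support x a x' h := by rw [initialOccupancy, if_neg h]

/-! ### Convexity of the confidence set -/

/-- The closeness of a normalized vector, without division. -/
theorem sum_abs_div_sub_le_iff {s : Finset X} {q e : X → ℝ} {r : ℝ}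
    (hq : ∀ y, 0 ≤ q y) :
    (∑ y ∈ s, q y ≠ 0 → ∑ x' ∈ s, |q x' / ∑ y ∈ s, q y - e x'| ≤ r) ↔
      ∑ x' ∈ s, |q x' - e x' * ∑ y ∈ s, q y| ≤ r * ∑ y ∈ s, q y := by
  set S := ∑ y ∈ s, q y with hS
  have hS0 : 0 ≤ S := Finset.sum_nonneg fun y _ => hq y
  rcases hS0.eq_or_lt with h0 | h0
  · have : ∀ y ∈ s, q y = 0 := (Finset.sum_eq_zero_iff_of_nonneg fun y _ => hq y).1 h0.symm
    rw [← h0]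
    simp only [ne_eq, not_true_eq_false, false_imp_iff, mul_zero, sub_zero, true_iff]
    exact (Finset.sum_eq_zero fun y hy => by rw [this y hy, abs_zero]).le
  · have e1 : ∑ x' ∈ s, |q x' - e x' * S| = (∑ x' ∈ s, |q x' / S - e x'|) * S := by
      rw [Finset.sum_mul]
      refine Finset.sum_congr rfl fun x' _ => ?_
      rw [← abs_of_pos h0, ← abs_mul, abs_of_pos h0, sub_mul, div_mul_cancel₀ _ h0.ne']
    rw [e1, mul_le_mul_iff_left₀ h0]
    exact ⟨fun h => h h0.ne', fun h _ => h⟩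

theorem InConfidenceSet.convex {δ : ℝ} {c : Counters X A} (hq : InConfidenceSet G T δ c q)
    (hq' : InConfidenceSet G T δ c q') {s : ℝ} (h0 : 0 ≤ s) (h1 : s ≤ 1) :
    InConfidenceSet G T δ c (fun x a x' => (1 - s) * q x a x' + s * q' x a x') where
  mem_cube := by
    have := (convex_Icc (0 : X → A → X → ℝ) 1) hq.mem_cube hq'.mem_cube (sub_nonneg.2 h1) h0
      (by ring)
    exact this
  support x a x' h := by rw [hq.support x a x' h, hq'.support x a x' h]; ring
  sum_eq_one k hk := by
    simp_rw [Finset.sum_add_distrib, ← Finset.mul_sum]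
    rw [hq.sum_eq_one k hk, hq'.sum_eq_one k hk]; ring
  flow x h h' := by
    simp_rw [Finset.sum_add_distrib, ← Finset.mul_sum]
    rw [hq.flow x h h', hq'.flow x h h']
  close x a hx := by
    have n1 : ∀ y, 0 ≤ q x a y := fun y => hq.mem_cube.1 x a y
    have n2 : ∀ y, 0 ≤ q' x a y := fun y => hq'.mem_cube.1 x a y
    have c1 := (sum_abs_div_sub_le_iff (s := G.states (G.layer x + 1)) (e := c.estimate x a) n1).1
      (hq.close x a hx)
    have c2 := (sum_abs_div_sub_le_iff (s := G.states (G.layer x + 1)) (e := c.estimate x a) n2).1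
      (hq'.close x a hx)
    refine (sum_abs_div_sub_le_iff (s := G.states (G.layer x + 1)) (e := c.estimate x a)
      fun y => add_nonneg (mul_nonneg (sub_nonneg.2 h1) (n1 y)) (mul_nonneg h0 (n2 y))).2 ?_
    simp_rw [Finset.sum_add_distrib, ← Finset.mul_sum]
    set S := ∑ y ∈ G.states (G.layer x + 1), q x a y
    set S' := ∑ y ∈ G.states (G.layer x + 1), q' x a y
    calc _ ≤ ∑ x' ∈ G.states (G.layer x + 1), ((1 - s) * |q x a x' - c.estimate x a x' * S| +
          s * |q' x a x' - c.estimate x a x' * S'|) := by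
          refine Finset.sum_le_sum fun x' _ => ?_
          have e1 := abs_mul (1 - s) (q x a x' - c.estimate x a x' * S)
          have e2 := abs_mul s (q' x a x' - c.estimate x a x' * S')
          rw [abs_of_nonneg (sub_nonneg.2 h1)] at e1
          rw [abs_of_nonneg h0] at e2
          rw [← e1, ← e2]
          refine le_trans (le_of_eq ?_) (abs_add_le _ _)
          congr 1; ring
      _ ≤ (1 - s) * (c.radius G T δ x a * S) + s * (c.radius G T δ x a * S') := by
          rw [Finset.sum_add_distrib, ← Finset.mul_sum, ← Finset.mul_sum]
          exact add_le_add (mul_le_mul_of_nonneg_left c1 (sub_nonneg.2 h1))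
            (mul_le_mul_of_nonneg_left c2 h0)
      _ = _ := by ring

/-! ### Positivity of the minimizers -/

/-- A summand of the objective of the mirror descent step. -/
def mirrorTerm (η z v u : ℝ) : ℝ := η * (u * z) + (u * Real.log (u / v) - u + v)

theorem mirrorObjective_eq (η : ℝ) (z q' q : X → A → X → ℝ) :
    mirrorObjective η z q' q =
      ∑ x, ∑ a, ∑ x', mirrorTerm η (z x a x') (q' x a x') (q x a x') := by
  simp_rw [mirrorTerm, Finset.sum_add_distrib, mirrorObjective, klDiv, Finset.mul_sum,
    Finset.sum_add_distrib]

theorem mirrorTerm_convex {η z v u w s : ℝ} (hv : 0 < v) (hu : 0 ≤ u) (hw : 0 ≤ w) (h0 : 0 ≤ s)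
    (h1 : s ≤ 1) : mirrorTerm η z v ((1 - s) * u + s * w) ≤
      (1 - s) * mirrorTerm η z v u + s * mirrorTerm η z v w := by
  have h := Real.convexOn_mul_log.2 (Set.mem_Ici.2 (div_nonneg hu hv.le))
    (Set.mem_Ici.2 (div_nonneg hw hv.le)) (sub_nonneg.2 h1) h0 (by ring)
  simp only [smul_eq_mul] at h
  rw [show (1 - s) * (u / v) + s * (w / v) = ((1 - s) * u + s * w) / v by ring] at h
  have h' := mul_le_mul_of_nonneg_left h hv.le
  have e : ∀ y m, v * (y / v * m) = y * m := fun y m => by field_simp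
  rw [e, mul_add, mul_left_comm, e, mul_left_comm v s, e] at h'
  unfold mirrorTerm
  linarith

theorem mirrorTerm_zero_mix {η z v w s : ℝ} (hv : 0 < v) (hw : 0 < w) (h0 : 0 < s) :
    mirrorTerm η z v ((1 - s) * 0 + s * w) =
      (1 - s) * mirrorTerm η z v 0 + s * mirrorTerm η z v w + s * (w * Real.log s) := by
  unfold mirrorTerm
  rw [mul_zero, zero_add, mul_div_assoc, Real.log_mul h0.ne' (div_pos hw hv).ne']
  ring

/-- The minimizer of the mirror descent objective over a confidence set which has a positive
element is positive. -/
theorem InConfidenceSet.isPositive_of_min {δ η : ℝ} {c : Counters X A} {z v : X → A → X → ℝ}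
    (hv : IsPositive G v) (hq' : InConfidenceSet G T δ c q') (hq'pos : IsPositive G q')
    (hq : InConfidenceSet G T δ c q)
    (hmin : ∀ u, InConfidenceSet G T δ c u → mirrorObjective η z v q ≤ mirrorObjective η z v u) :
    IsPositive G q := by
  refine ⟨fun x a x' hx => ?_, hq.support⟩
  refine lt_of_le_of_ne (hq.mem_cube.1 x a x') fun hzero => ?_
  have hw := hq'pos.pos x a x' hx
  set D := mirrorObjective η z v q' - mirrorObjective η z v q with hD
  have hD0 : 0 ≤ D := sub_nonneg.2 (hmin q' hq')
  set s := Real.exp (-(D + 1) / q' x a x') with hs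
  have s0 : 0 < s := Real.exp_pos _
  have s1 : s ≤ 1 := Real.exp_le_one_iff.2
    (div_nonpos_of_nonpos_of_nonneg (by linarith) hw.le)
  have key : ∀ y b y', mirrorTerm η (z y b y') (v y b y') ((1 - s) * q y b y' + s * q' y b y') ≤
      (1 - s) * mirrorTerm η (z y b y') (v y b y') (q y b y') +
        s * mirrorTerm η (z y b y') (v y b y') (q' y b y') := by
    intro y b y'
    by_cases hy : G.layer y' = G.layer y + 1
    · exact mirrorTerm_convex (hv.pos y b y' hy) (hq.mem_cube.1 y b y') (hq'.mem_cube.1 y b y')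
        s0.le s1
    · simp [hq.support y b y' hy, hq'.support y b y' hy, hv.support y b y' hy, mirrorTerm]
  have hsum : mirrorObjective η z v (fun x a x' => (1 - s) * q x a x' + s * q' x a x') ≤
      (1 - s) * mirrorObjective η z v q + s * mirrorObjective η z v q' +
        s * (q' x a x' * Real.log s) := by
    classical
    have key2 : ∀ y b y',
        mirrorTerm η (z y b y') (v y b y') ((1 - s) * q y b y' + s * q' y b y') ≤
        (1 - s) * mirrorTerm η (z y b y') (v y b y') (q y b y') +
          s * mirrorTerm η (z y b y') (v y b y') (q' y b y') +
          if y = x then if b = a then if y' = x' then s * (q' x a x' * Real.log s)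
            else 0 else 0 else 0 := by
      intro y b y'
      split_ifs with e1 e2 e3
      · subst e1 e2 e3
        rw [← hzero, mirrorTerm_zero_mix (hv.pos _ _ _ hx) hw s0]
      all_goals rw [add_zero]; exact key y b y'
    simp_rw [mirrorObjective_eq]
    refine (Finset.sum_le_sum fun y _ => Finset.sum_le_sum fun b _ =>
      Finset.sum_le_sum fun y' _ => key2 y b y').trans_eq ?_
    simp_rw [Finset.sum_add_distrib, ← Finset.mul_sum]
    simp
  have h := (hmin _ (hq.convex hq' s0.le s1)).trans hsum
  have e : q' x a x' * Real.log s = -(D + 1) := by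
    rw [hs, Real.log_exp]; field_simp
  rw [e] at h
  nlinarith

/-! ### A positive element of the confidence set -/

theorem stateDist_pos [Nonempty A] (hP : IsTransition G P) (hPpos : IsPositive G P)
    (hp : IsPolicy G p) (hppos : ∀ x a, 0 < p x a) {k : ℕ} (hk : k ≤ L) {x : X}
    (hx : G.layer x = k) : 0 < stateDist G P p k x := by
  induction k generalizing x with
  | zero =>
    rw [G.layer_eq_zero_iff] at hx
    simp [stateDist, pathMass, initialMass, hx]
  | succ k ih =>
    obtain ⟨y, hy⟩ := hP.states_nonempty (k := k) (by omega)
    rw [Layering.mem_states] at hy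
    have nn : ∀ y a, 0 ≤ stateDist G P p k y * (p y a * P y a x) := fun y a =>
      mul_nonneg (stateDist_nonneg hP hp (by omega) y)
        (mul_nonneg (hppos y a).le (hP.nonneg y a x))
    rw [stateDist_succ]
    refine Finset.sum_pos' (fun y _ => Finset.sum_nonneg fun a _ => nn y a)
      ⟨y, Finset.mem_univ y, Finset.sum_pos' (fun a _ => nn y a)
        ⟨Classical.arbitrary A, Finset.mem_univ _, ?_⟩⟩
    exact mul_pos (ih (by omega) hy) (mul_pos (hppos _ _) (hPpos.pos _ _ _ (by omega)))

theorem occupancy_nonneg (hP : IsTransition G P) (hp : IsPolicy G p) (x : X) (a : A) (x' : X) :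
    0 ≤ occupancy G P p x a x' := by
  rw [occupancy_eq hP hp]
  split_ifs with h
  · exact mul_nonneg (stateDist_nonneg hP hp h.le x)
      (mul_nonneg (hp.nonneg x a h) (hP.nonneg x a x'))
  · exact le_rfl

theorem occupancy_mem_cube (hP : IsTransition G P) (hp : IsPolicy G p) :
    occupancy G P p ∈ cube X A := by
  have nn := occupancy_nonneg hP hp
  refine ⟨fun x a x' => nn x a x', fun x a x' => ?_⟩
  by_cases hx : G.layer x < L
  · calc occupancy G P p x a x' ≤ ∑ y, occupancy G P p x a y :=
          Finset.single_le_sum (fun y _ => nn x a y) (Finset.mem_univ x')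
      _ ≤ ∑ b, ∑ y, occupancy G P p x b y :=
          Finset.single_le_sum (f := fun b => ∑ y, occupancy G P p x b y)
            (fun b _ => Finset.sum_nonneg fun y _ => nn x b y) (Finset.mem_univ a)
      _ = stateDist G P p (G.layer x) x := sum_occupancy hP hp hx
      _ ≤ ∑ y, stateDist G P p (G.layer x) y :=
          Finset.single_le_sum (fun y _ => stateDist_nonneg hP hp hx.le y) (Finset.mem_univ x)
      _ = 1 := sum_stateDist hP hp hx.le
  · rw [occupancy_eq hP hp, if_neg hx]; exact zero_le_one

theorem inConfidenceSet_occupancy (hP : IsTransition G P) (hp : IsPolicy G p) {δ : ℝ}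
    {c : Counters X A}
    (hc : ∀ x a, G.layer x < L → ∑ x' ∈ G.states (G.layer x + 1), |P x a x' - c.estimate x a x'| ≤
      c.radius G T δ x a) :
    InConfidenceSet G T δ c (occupancy G P p) := by
  have supp : ∀ x a x', G.layer x' ≠ G.layer x + 1 → occupancy G P p x a x' = 0 := by
    intro x a x' h
    have : P x a x' = 0 := by
      by_contra h'
      exact h (hP.loop_free x a x' h')
    simp [occupancy_eq hP hp, this]
  have tot : ∀ x, G.layer x < L → ∑ a, ∑ x' ∈ G.states (G.layer x + 1), occupancy G P p x a x' =
      stateDist G P p (G.layer x) x := by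
    intro x hx
    rw [← sum_occupancy hP hp hx]
    exact Finset.sum_congr rfl fun a _ => G.sum_states_eq (supp x a)
  refine ⟨occupancy_mem_cube hP hp, supp, ?_, ?_, ?_⟩
  · intro k hk
    rw [← sum_stateDist hP hp hk.le, ← G.sum_states_eq fun x hx => stateDist_eq_zero hP hx]
    refine Finset.sum_congr rfl fun x hx => ?_
    rw [Layering.mem_states] at hx
    subst hx
    exact tot x hk
  · intro x h0 hL
    rw [Finset.sum_comm, tot x hL]
    obtain ⟨k, hk⟩ := Nat.exists_eq_succ_of_ne_zero h0.ne'
    rw [hk, Nat.succ_eq_add_one, Nat.add_sub_cancel, stateDist_succ]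
    rw [G.sum_states_eq (k := k) (g := fun y => ∑ a, occupancy G P p y a x)
      fun y hy => Finset.sum_eq_zero fun a _ => supp y a x (by omega)]
    refine Finset.sum_congr rfl fun y _ => Finset.sum_congr rfl fun a _ => ?_
    rw [occupancy_eq hP hp]
    by_cases hy : G.layer y = k
    · rw [if_pos (by omega), hy]
    · have : P y a x = 0 := by
        by_contra h'
        have := hP.loop_free y a x h'
        omega
      simp [this]
  · intro x a hx hne
    refine le_trans (le_of_eq (Finset.sum_congr rfl fun x' hx' => ?_)) (hc x a hx)
    have h1 : ∀ y, occupancy G P p x a y = stateDist G P p (G.layer x) x * p x a * P x a y :=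
      fun y => by rw [occupancy_eq hP hp, if_pos hx, mul_assoc]
    have h2 : ∑ y ∈ G.states (G.layer x + 1), occupancy G P p x a y =
        stateDist G P p (G.layer x) x * p x a := by
      rw [G.sum_states_eq (supp x a)]
      simp_rw [h1]
      rw [← Finset.mul_sum, hP.sum_eq_one x a hx, mul_one]
    rw [h2] at hne
    rw [inducedTransition, h2, h1, mul_div_cancel_left₀ _ hne]

/-- The counters of a nonterminal pair are consistent: the transitions add up to the visits. -/
def Counters.IsConsistent (c : Counters X A) (G : Layering X L) : Prop :=
  ∀ x a, G.layer x < L → ∑ x' ∈ G.states (G.layer x + 1), c.M x a x' = c.N x a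

theorem Counters.IsConsistent.sum_estimate {c : Counters X A} (hc : c.IsConsistent G) {x : X}
    {a : A} (hx : G.layer x < L) (hN : c.N x a ≠ 0) :
    ∑ x' ∈ G.states (G.layer x + 1), c.estimate x a x' = 1 := by
  have h1 : (1 : ℝ) ≤ c.N x a := by exact_mod_cast Nat.one_le_iff_ne_zero.2 hN
  simp_rw [Counters.estimate]
  rw [← Finset.sum_div, max_eq_right h1, ← Nat.cast_sum, hc x a hx]
  exact div_self (by positivity)

theorem Counters.IsConsistent.estimate_eq_zero {c : Counters X A} (hc : c.IsConsistent G)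
    {x x' : X} {a : A} (hx : G.layer x < L) (hN : c.N x a = 0) (hx' : x' ∈ G.states (G.layer x + 1)) :
    c.estimate x a x' = 0 := by
  have h := hc x a hx
  rw [hN] at h
  rw [Counters.estimate, (Finset.sum_eq_zero_iff.1 h) x' hx']
  simp

theorem Counters.estimate_nonneg (c : Counters X A) (x : X) (a : A) (x' : X) :
    0 ≤ c.estimate x a x' := by
  unfold Counters.estimate; positivity

theorem exists_inConfidenceSet_isPositive [Nonempty A] (hP : IsTransition G P) {δ : ℝ}
    {c : Counters X A} (hc : c.IsConsistent G)
    (hr : ∀ x a, G.layer x < L → 0 < c.radius G T δ x a)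
    (hr1 : ∀ x a, G.layer x < L → c.N x a = 0 → 1 ≤ c.radius G T δ x a) :
    ∃ q : X → A → X → ℝ, InConfidenceSet G T δ c q ∧ IsPositive G q := by
  classical
  set s : X → A → ℝ := fun x a => if c.N x a = 0 then 1 else min 1 (c.radius G T δ x a / 2)
    with hs
  have s0 : ∀ x a, G.layer x < L → 0 < s x a := fun x a hx => by
    simp only [hs]; split_ifs
    · exact one_pos
    · exact lt_min one_pos (half_pos (hr x a hx))
  have s1 : ∀ x a, s x a ≤ 1 := fun x a => by
    simp only [hs]; split_ifs
    · exact le_rfl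
    · exact min_le_left _ _
  set m : X → ℝ := fun x => (G.states (G.layer x + 1)).card with hm
  have m0 : ∀ x, G.layer x < L → 0 < m x := fun x hx => by
    simp only [hm]; exact_mod_cast Finset.card_pos.2 (hP.states_nonempty hx)
  have lt_of : ∀ {x x'}, G.layer x' = G.layer x + 1 → G.layer x < L := fun {x x'} h => by
    have := G.layer_le x'; omega
  set Q : X → A → X → ℝ := fun x a x' => if G.layer x' = G.layer x + 1 then
    (1 - s x a) * c.estimate x a x' + s x a * (1 / m x) else 0 with hQ
  have Qpos : IsPositive G Q := by
    refine ⟨fun x a x' h => ?_, fun x a x' h => by simp [hQ, h]⟩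
    simp only [hQ, if_pos h]
    exact add_pos_of_nonneg_of_pos
      (mul_nonneg (sub_nonneg.2 (s1 x a)) (c.estimate_nonneg x a x'))
      (mul_pos (s0 x a (lt_of h)) (one_div_pos.2 (m0 x (lt_of h))))
  have Qsum : ∀ x a, ∑ x' ∈ G.states (G.layer x + 1), Q x a x' =
      (1 - s x a) * ∑ x' ∈ G.states (G.layer x + 1), c.estimate x a x' +
        s x a * (m x * (1 / m x)) := by
    intro x a
    rw [Finset.sum_congr rfl fun x' hx' => if_pos (Layering.mem_states.1 hx')]
    rw [Finset.sum_add_distrib, ← Finset.mul_sum, Finset.sum_const, nsmul_eq_mul]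
    ring
  have QT : IsTransition G Q := by
    refine ⟨Qpos.nonneg, fun x a x' h => ?_, fun x a hx => ?_⟩
    · by_contra h'
      exact h (Qpos.support x a x' h')
    · rw [← G.sum_states_eq fun y hy => Qpos.support x a y hy, Qsum,
        mul_one_div_cancel (m0 x hx).ne']
      by_cases hN : c.N x a = 0
      · simp [hs, hN]
      · rw [hc.sum_estimate hx hN]; ring
  set u : X → A → ℝ := fun _ _ => 1 / Fintype.card A with hu
  have hA : (0 : ℝ) < Fintype.card A := by exact_mod_cast Fintype.card_pos
  have upos : ∀ x a, 0 < u x a := fun x a => one_div_pos.2 hA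
  have up : IsPolicy G u := ⟨fun x a _ => (upos x a).le, fun x _ => by simp [hu]⟩
  refine ⟨occupancy G Q u, inConfidenceSet_occupancy QT up ?_, ?_, ?_⟩
  · intro x a hx
    by_cases hN : c.N x a = 0
    · refine le_trans (le_of_eq ?_) (hr1 x a hx hN)
      rw [← QT.sum_eq_one x a hx, ← G.sum_states_eq fun y hy => Qpos.support x a y hy]
      exact Finset.sum_congr rfl fun y hy => by
        rw [hc.estimate_eq_zero hx hN hy, sub_zero, abs_of_nonneg (Qpos.nonneg x a y)]
    · calc _ ≤ ∑ x' ∈ G.states (G.layer x + 1), (s x a * (1 / m x) + s x a * c.estimate x a x') := by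
            refine Finset.sum_le_sum fun x' hx' => ?_
            simp only [hQ, if_pos (Layering.mem_states.1 hx')]
            have h1 := mul_nonneg (s0 x a hx).le (c.estimate_nonneg x a x')
            have h2 := mul_nonneg (s0 x a hx).le (one_div_pos.2 (m0 x hx)).le
            rw [abs_le]; constructor <;> linarith
        _ = s x a * 2 := by
            rw [Finset.sum_add_distrib, ← Finset.mul_sum, ← Finset.mul_sum,
              hc.sum_estimate hx hN, Finset.sum_const, nsmul_eq_mul,
              show ((G.states (G.layer x + 1)).card : ℝ) = m x from rfl,
              mul_one_div_cancel (m0 x hx).ne']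
            ring
        _ ≤ _ := by
            have : s x a ≤ c.radius G T δ x a / 2 := by
              simp only [hs, if_neg hN]; exact min_le_right _ _
            linarith
  · intro x a x' h
    rw [occupancy_eq QT up, if_pos (lt_of h)]
    exact mul_pos (stateDist_pos QT Qpos up upos (lt_of h).le rfl)
      (mul_pos (upos x a) (Qpos.pos x a x' h))
  · intro x a x' h
    simp [occupancy_eq QT up, Qpos.support x a x' h]

end

section

/-! ### Counting visits -/

variable {G : Layering X L}

open Classical in
/-- Whether the trajectory visits `(x,a)`, as a number. -/
def Trajectory.visit (U : Trajectory G A) (x : X) (a : A) : ℕ :=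
  if ∃ k : Fin L, U.state k.castSucc = x ∧ U.action k = a then 1 else 0

open Classical in
/-- Whether the trajectory contains the transition `(x,a,x')`, as a number. -/
def Trajectory.transit (U : Trajectory G A) (x : X) (a : A) (x' : X) : ℕ :=
  if ∃ k : Fin L, U.state k.castSucc = x ∧ U.action k = a ∧ U.state k.succ = x' then 1 else 0

/-- The number of visits of `(x,a)`. -/
def visits (h : List (Trajectory G A)) (x : X) (a : A) : ℕ := (h.map fun U => U.visit x a).sum

/-- The number of transitions `(x,a,x')`. -/
def transits (h : List (Trajectory G A)) (x : X) (a : A) (x' : X) : ℕ :=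
  (h.map fun U => U.transit x a x').sum

theorem visits_append (h h' : List (Trajectory G A)) (x : X) (a : A) :
    visits (h ++ h') x a = visits h x a + visits h' x a := by simp [visits]

theorem transits_append (h h' : List (Trajectory G A)) (x : X) (a : A) (x' : X) :
    transits (h ++ h') x a x' = transits h x a x' + transits h' x a x' := by simp [transits]

theorem visits_singleton (U : Trajectory G A) (x : X) (a : A) : visits [U] x a = U.visit x a := by
  simp [visits]

theorem transits_singleton (U : Trajectory G A) (x : X) (a : A) (x' : X) :
    transits [U] x a x' = U.transit x a x' := by simp [transits]

theorem visits_mono {h h' : List (Trajectory G A)} (hh : h <+: h') (x : X) (a : A) :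
    visits h x a ≤ visits h' x a := by
  obtain ⟨l, rfl⟩ := hh
  rw [visits_append]
  exact Nat.le_add_right _ _

open Classical in
theorem Trajectory.visit_eq (U : Trajectory G A) {x : X} (hx : G.layer x < L) (a : A) :
    U.visit x a = if U.state (⟨G.layer x, hx⟩ : Fin L).castSucc = x ∧
      U.action ⟨G.layer x, hx⟩ = a then 1 else 0 := by
  rw [Trajectory.visit]
  refine if_congr ⟨?_, fun h => ⟨_, h⟩⟩ rfl rfl
  rintro ⟨k, h1, h2⟩
  obtain rfl := U.eq_of_state_eq h1 hx
  exact ⟨h1, h2⟩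

open Classical in
theorem Trajectory.transit_eq (U : Trajectory G A) {x : X} (hx : G.layer x < L) (a : A) (x' : X) :
    U.transit x a x' = if U.state (⟨G.layer x, hx⟩ : Fin L).castSucc = x ∧
      U.action ⟨G.layer x, hx⟩ = a ∧ U.state (⟨G.layer x, hx⟩ : Fin L).succ = x'
      then 1 else 0 := by
  rw [Trajectory.transit]
  refine if_congr ⟨?_, fun h => ⟨_, h⟩⟩ rfl rfl
  rintro ⟨k, h1, h2⟩
  obtain rfl := U.eq_of_state_eq h1 hx
  exact ⟨h1, h2⟩

open Classical in
theorem Trajectory.sum_transit (U : Trajectory G A) {x : X} (hx : G.layer x < L) (a : A)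
    (Y : Finset X) : ∑ y ∈ Y, U.transit x a y = if
      (U.state (⟨G.layer x, hx⟩ : Fin L).castSucc = x ∧ U.action ⟨G.layer x, hx⟩ = a) ∧
        U.state (⟨G.layer x, hx⟩ : Fin L).succ ∈ Y then 1 else 0 := by
  simp_rw [U.transit_eq hx, ← and_assoc]
  by_cases h : U.state (⟨G.layer x, hx⟩ : Fin L).castSucc = x ∧ U.action ⟨G.layer x, hx⟩ = a
  · simp only [h, and_self, true_and, Finset.sum_ite_eq]
  · simp only [h, false_and, if_false, Finset.sum_const_zero]

theorem sum_transits {x : X} (hx : G.layer x < L) (a : A) (h : List (Trajectory G A)) :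
    ∑ x' ∈ G.states (G.layer x + 1), transits h x a x' = visits h x a := by
  classical
  induction h with
  | nil => simp [transits, visits]
  | cons U h ih =>
    have e : U.state (⟨G.layer x, hx⟩ : Fin L).succ ∈ G.states (G.layer x + 1) := by
      rw [Layering.mem_states, U.layer_state]; rfl
    rw [← List.singleton_append, visits_append, ← ih, visits_singleton, U.visit_eq hx]
    simp_rw [transits_append, Finset.sum_add_distrib, transits_singleton]
    rw [U.sum_transit hx]
    simp only [e, and_true]

theorem Trajectory.sum_visit (U : Trajectory G A) (k : Fin L) (g : X → A → ℝ) :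
    ∑ x ∈ G.states k, ∑ a, U.visit x a * g x a = g (U.state k.castSucc) (U.action k) := by
  classical
  have h1 : ∀ x ∈ G.states k, ∀ a, (U.visit x a : ℝ) * g x a =
      if U.state k.castSucc = x then if U.action k = a then g x a else 0 else 0 := by
    intro x hx a
    rw [Layering.mem_states] at hx
    have hx' : G.layer x < L := hx ▸ k.isLt
    obtain rfl : k = ⟨G.layer x, hx'⟩ := Fin.ext hx.symm
    rw [U.visit_eq hx']
    split_ifs <;> simp_all
  rw [Finset.sum_congr rfl fun x hx => Finset.sum_congr rfl fun a _ => h1 x hx a]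
  rw [Finset.sum_eq_single (U.state k.castSucc)]
  · simp
  · intro x _ hx; simp [hx.symm]
  · intro h
    exact absurd (Layering.mem_states.2 (U.layer_castSucc k)) h

theorem sum_visits (h : List (Trajectory G A)) (k : Fin L) :
    ∑ x ∈ G.states k, ∑ a, (visits h x a : ℝ) = h.length := by
  induction h with
  | nil => simp [visits]
  | cons U h ih =>
    have e := U.sum_visit k fun _ _ => 1
    simp only [mul_one] at e
    rw [← List.singleton_append]
    simp_rw [visits_append, visits_singleton, Nat.cast_add, Finset.sum_add_distrib]
    rw [ih, e]
    simp [add_comm]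

/-! ### Invariants of the counters -/

theorem countersAfter_append (h : List (Trajectory G A)) (U : Trajectory G A) :
    countersAfter (h ++ [U]) = (countersAfter h).update U := by
  simp [countersAfter]

theorem Counters.record_n (c : Counters X A) (U : Trajectory G A) (x : X) (a : A) :
    (c.record U).n x a = c.n x a + U.visit x a := rfl

theorem countersAfter_add (h : List (Trajectory G A)) :
    (∀ x a, (countersAfter h).N x a + (countersAfter h).n x a = visits h x a) ∧
    ∀ x a x', (countersAfter h).M x a x' + (countersAfter h).m x a x' = transits h x a x' := by
  induction h using List.reverseRecOn with
  | nil => simp [countersAfter, Counters.init, visits, transits]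
  | append_singleton h U ih =>
    simp_rw [countersAfter_append, visits_append, transits_append, visits_singleton,
      transits_singleton, ← ih.1, ← ih.2]
    rw [Counters.update]
    split_ifs
    · exact ⟨fun x a => (add_assoc ((countersAfter h).N x a) _ _).symm,
        fun x a x' => (add_assoc ((countersAfter h).M x a x') _ _).symm⟩
    · exact ⟨fun x a => (add_assoc _ _ _).symm, fun x a x' => (add_assoc _ _ _).symm⟩

/-- The counters are those of the history at the beginning of the epoch. -/
theorem exists_prefix_counters (h : List (Trajectory G A)) :
    ∃ h', h' <+: h ∧ (∀ x a, (countersAfter h).N x a = visits h' x a) ∧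
      ∀ x a x', (countersAfter h).M x a x' = transits h' x a x' := by
  induction h using List.reverseRecOn with
  | nil => exact ⟨[], List.prefix_rfl, by simp [countersAfter, Counters.init, visits, transits]⟩
  | append_singleton h U ih =>
    obtain ⟨h', hh, h1, h2⟩ := ih
    have hadd := countersAfter_add (h ++ [U])
    rw [countersAfter_append, Counters.update] at *
    split_ifs at * with hc
    · exact ⟨h ++ [U], List.prefix_rfl, fun x a => hadd.1 x a, fun x a x' => hadd.2 x a x'⟩
    · exact ⟨h', hh.trans (List.prefix_append _ _), h1, h2⟩

theorem isConsistent_countersAfter (h : List (Trajectory G A)) :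
    (countersAfter h).IsConsistent G := by
  intro x a hx
  obtain ⟨h', -, h1, h2⟩ := exists_prefix_counters h
  rw [h1, ← sum_transits hx]
  exact Finset.sum_congr rfl fun y _ => h2 x a y

theorem countersAfter_n (h : List (Trajectory G A)) {x : X} (hx : G.layer x < L) (a : A) :
    (countersAfter h).n x a = 0 ∨ (countersAfter h).n x a < (countersAfter h).N x a := by
  induction h using List.reverseRecOn with
  | nil => left; rfl
  | append_singleton h U ih =>
    rw [countersAfter_append, Counters.update]
    split_ifs with hc
    · left; rfl
    · right
      push Not at hc
      exact hc x a hx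

theorem Trajectory.visit_le_one (U : Trajectory G A) (x : X) (a : A) : U.visit x a ≤ 1 := by
  rw [Trajectory.visit]; split_ifs <;> simp

/-- The potential of the visits of `(x,a)`. -/
def visitPotential (h : List (Trajectory G A)) (x : X) (a : A) : ℝ :=
  5 / 2 * √((countersAfter h).N x a) +
    (countersAfter h).n x a / √(max 1 ((countersAfter h).N x a : ℝ))

theorem visitPotential_append (h : List (Trajectory G A)) (U : Trajectory G A) {x : X}
    (hx : G.layer x < L) (a : A) :
    visitPotential h x a + U.visit x a / √(max 1 ((countersAfter h).N x a : ℝ)) ≤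
      visitPotential (h ++ [U]) x a := by
  have hn := countersAfter_n h hx a
  have hU := U.visit_le_one x a
  rw [visitPotential, visitPotential, countersAfter_append, Counters.update]
  set c := countersAfter h
  rw [add_assoc, ← add_div, ← Nat.cast_add, ← Counters.record_n]
  split_ifs with hc
  · change _ ≤ 5 / 2 * √((c.N x a + (c.record U).n x a : ℕ) : ℝ) + ((0 : ℕ) : ℝ) / _
    rw [Nat.cast_zero, zero_div, add_zero, Nat.cast_add]
    have cases : ∀ m : ℕ, (m : ℝ) = 0 ∨ 1 ≤ (m : ℝ) := fun m => by
      rcases Nat.eq_zero_or_pos m with h | h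
      · left; simp [h]
      · right; exact_mod_cast h
    refine sqrt_add_div_sqrt_le (Nat.cast_nonneg _) (Nat.cast_nonneg _) ?_ (cases _) (cases _)
    rw [← Nat.cast_one, ← Nat.cast_max, Nat.cast_le, Counters.record_n]
    omega
  · exact le_rfl

theorem sum_telescope {S : Type*} {E : ℝ} (ω : Fin T → S) (Φ : List S → ℝ) (w : Fin T → ℝ)
    (hw : ∀ t, Φ (history ω t) + w t ≤ Φ (history ω t ++ [ω t])) (hE : Φ (List.ofFn ω) ≤ E) :
    Φ [] + ∑ t, w t ≤ E := by
  have h : ∀ t : Fin T, w t ≤ Φ ((List.ofFn ω).take (t + 1)) - Φ ((List.ofFn ω).take t) := by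
    intro t
    rw [← history_append]
    linarith [hw t, show Φ ((List.ofFn ω).take t) = Φ (history ω t) from rfl]
  have h2 := Finset.sum_le_sum fun t (_ : t ∈ Finset.univ) => h t
  rw [Fin.sum_univ_eq_sum_range (fun t => Φ ((List.ofFn ω).take (t + 1)) -
    Φ ((List.ofFn ω).take t)), Finset.sum_range_sub (fun t => Φ ((List.ofFn ω).take t)),
    List.take_of_length_le (by simp)] at h2
  simp only [List.take_zero] at h2
  linarith

theorem sum_visit_div_sqrt_le (ω : Fin T → Trajectory G A) {x : X} (hx : G.layer x < L) (a : A) :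
    ∑ t, (ω t).visit x a / √(max 1 ((countersAfter (history ω t)).N x a : ℝ)) ≤
      5 / 2 * √(visits (List.ofFn ω) x a) := by
  have h := sum_telescope ω (fun h => visitPotential h x a)
    (fun t => (ω t).visit x a / √(max 1 ((countersAfter (history ω t)).N x a : ℝ)))
    (E := 5 / 2 * √(visits (List.ofFn ω) x a))
    (fun t => visitPotential_append _ _ hx a) ?_
  · simpa [visitPotential, countersAfter, Counters.init] using h
  · have e := (countersAfter_add (List.ofFn ω)).1 x a
    have hn := countersAfter_n (List.ofFn ω) hx a
    rw [visitPotential, ← e, Nat.cast_add]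
    have cases : ∀ m : ℕ, (m : ℝ) = 0 ∨ 1 ≤ (m : ℝ) := fun m => by
      rcases Nat.eq_zero_or_pos m with h | h
      · left; simp [h]
      · right; exact_mod_cast h
    refine sqrt_add_div_sqrt_le (Nat.cast_nonneg _) (Nat.cast_nonneg _) ?_ (cases _) (cases _)
    rw [← Nat.cast_one, ← Nat.cast_max, Nat.cast_le]
    omega

/-- The sum of the confidence radii along the steps from the `k`-th layer, up to the factor
which depends on the layer only. -/
theorem sum_one_div_sqrt_le (ω : Fin T → Trajectory G A) (k : Fin L) :
    ∑ t, 1 / √(max 1 ((countersAfter (history ω t)).N ((ω t).state k.castSucc)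
      ((ω t).action k) : ℝ)) ≤
      5 / 2 * √((G.states k).card * Fintype.card A * T) := by
  have e : ∀ t, 1 / √(max 1 ((countersAfter (history ω t)).N ((ω t).state k.castSucc)
      ((ω t).action k) : ℝ)) = ∑ x ∈ G.states k, ∑ a,
        (ω t).visit x a / √(max 1 ((countersAfter (history ω t)).N x a : ℝ)) := by
    intro t
    rw [← (ω t).sum_visit k fun x a =>
      1 / √(max 1 ((countersAfter (history ω t)).N x a : ℝ))]
    simp_rw [mul_one_div]
  simp_rw [e]
  rw [Finset.sum_comm]
  simp_rw [Finset.sum_comm (s := (Finset.univ : Finset (Fin T)))]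
  calc _ ≤ ∑ x ∈ G.states k, ∑ a, 5 / 2 * √(visits (List.ofFn ω) x a : ℝ) :=
        Finset.sum_le_sum fun x hx => Finset.sum_le_sum fun a _ =>
          sum_visit_div_sqrt_le ω (by rw [Layering.mem_states.1 hx]; exact k.isLt) a
    _ ≤ _ := by
        simp_rw [← Finset.mul_sum]
        refine mul_le_mul_of_nonneg_left ?_ (by norm_num)
        rw [← Finset.sum_product']
        refine Real.le_sqrt_of_sq_le ?_
        refine (sq_sum_le_card_mul_sum_sq).trans ?_
        simp_rw [Real.sq_sqrt (Nat.cast_nonneg _)]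
        rw [Finset.sum_product' (f := fun x a => (visits (List.ofFn ω) x a : ℝ)), sum_visits,
          Finset.card_product, Finset.card_univ]
        simp

end

section

/-! ### Concentration along a run -/

open Classical in
/-- The **Azuma–Hoeffding inequality** for the conditional expectations of `Z`. -/
theorem azuma {S : Type*} [Fintype S] (hT : 0 < T) {p Z : List S → S → ℝ} {B : ℝ} (hB : 0 < B)
    (hp : ∀ h, h.length < T → ∀ s, 0 ≤ p h s) (hp1 : ∀ h, h.length < T → ∑ s, p h s = 1)
    (hZ : ∀ h, h.length < T → ∀ s, Z h s ∈ Set.Icc 0 B) {c : ℝ} (hc : 0 ≤ c) :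
    (∑ ω : Fin T → S, if c ≤ ∑ t, (∑ s, p (history ω t) s * Z (history ω t) s -
        Z (history ω t) (ω t)) then ∏ t, p (history ω t) (ω t) else 0) ≤
      Real.exp (-(2 * c ^ 2 / (T * B ^ 2))) := by
  have hT' : (0 : ℝ) < T := by exact_mod_cast hT
  set r : ℝ := 4 * c / (T * B ^ 2) with hr
  have hr0 : 0 ≤ r := by positivity
  set w : List S → S → ℝ := fun h s =>
    r * (∑ s, p h s * Z h s - Z h s) - r ^ 2 * B ^ 2 / 8 with hw
  refine le_trans (Finset.sum_le_sum fun ω _ => ?_)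
    (sum_ite_le_exp_neg (w := w) hp (fun h hh => ?_) (2 * c ^ 2 / (T * B ^ 2)))
  · have h0 : 0 ≤ ∏ t, p (history ω t) (ω t) :=
      Finset.prod_nonneg fun t _ => hp _ (by rw [length_history]; exact t.isLt) _
    split_ifs with h1 h2 h2
    · exact le_rfl
    · refine absurd ?_ h2
      simp only [hw]
      rw [Finset.sum_sub_distrib, ← Finset.mul_sum, Finset.sum_const, Finset.card_univ,
        Fintype.card_fin, nsmul_eq_mul]
      have h3 := mul_le_mul_of_nonneg_left h1 hr0
      have h4 : r * c - T * (r ^ 2 * B ^ 2 / 8) = 2 * c ^ 2 / (T * B ^ 2) := by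
        rw [hr]; field_simp; ring
      linarith
    · exact h0
    · exact le_rfl
  · have h1 := sum_mul_exp_le (hp h hh) (hp1 h hh) (hZ h hh) (-r)
    simp only [hw, Real.exp_sub]
    simp_rw [← mul_div_assoc]
    rw [← Finset.sum_div, div_le_one (Real.exp_pos _)]
    refine le_trans (le_of_eq (Finset.sum_congr rfl fun s _ => ?_)) (h1.trans_eq ?_)
    · congr 2; ring
    · congr 1; ring

variable {G : Layering X L} {P : X → A → X → ℝ}

/-- The exponent of the deviation of the transitions from `(x,a)` to `Y`, up to
the `n`-th visit. -/
def deviation (P : X → A → X → ℝ) (x : X) (a : A) (n : ℕ) (Y : Finset X) (r : ℝ)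
    (h : List (Trajectory G A)) (U : Trajectory G A) : ℝ :=
  if visits h x a < n then
    r * (((∑ y ∈ Y, U.transit x a y : ℕ) : ℝ) - U.visit x a * ∑ y ∈ Y, P x a y) -
      r ^ 2 / 8 * U.visit x a
  else 0

theorem sum_mul_exp_deviation_le (hP : IsTransition G P) {p : X → A → ℝ} (hp : IsPolicy G p)
    {x : X} (hx : G.layer x < L) (a : A) (n : ℕ) (Y : Finset X) (r : ℝ)
    (h : List (Trajectory G A)) :
    ∑ U : Trajectory G A, trajProb P p U * Real.exp (deviation P x a n Y r h U) ≤ 1 := by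
  classical
  by_cases hn : visits h x a < n
  swap
  · simp [deviation, hn, sum_trajProb hP hp]
  set k : Fin L := ⟨G.layer x, hx⟩
  set PY := ∑ y ∈ Y, P x a y with hPY
  set g : X → A → X → ℝ := fun y b y' => if y = x ∧ b = a then
    Real.exp (r * ((if y' ∈ Y then 1 else 0) - PY) - r ^ 2 / 8) else 1 with hg
  have e : ∀ U : Trajectory G A, Real.exp (deviation P x a n Y r h U) =
      g (U.state k.castSucc) (U.action k) (U.state k.succ) := by
    intro U
    rw [deviation, if_pos hn, U.sum_transit hx, U.visit_eq hx]
    by_cases h1 : U.state k.castSucc = x ∧ U.action k = a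
    · simp only [hg, k, h1, and_self, if_true, true_and]
      by_cases h2 : U.state k.succ ∈ Y
      · simp only [k] at h2; simp only [h2, if_true]; simp [hPY]
      · simp only [k] at h2; simp only [h2, if_false]; simp [hPY]
    · simp only [hg, k, h1, if_false, false_and]; simp
  simp_rw [e]
  rw [sum_trajProb_mul hP hp]
  rw [← sum_stateDist hP hp k.isLt.le]
  refine Finset.sum_le_sum fun y _ => ?_
  by_cases hy : G.layer y = k
  swap
  · simp [stateDist_eq_zero hP hy]
  have hyL : G.layer y < L := hy ▸ k.isLt
  have hin : ∀ b, ∑ y', P y b y' * g y b y' ≤ 1 := by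
    intro b
    by_cases h1 : y = x ∧ b = a
    · obtain ⟨rfl, rfl⟩ := h1
      have h2 := sum_mul_exp_le (z := fun y' => if y' ∈ Y then (1 : ℝ) else 0) (a := 0) (b := 1)
        (hP.nonneg y b) (hP.sum_eq_one y b hyL) (fun i => by split_ifs <;> simp) r
      have h3 : ∑ y', P y b y' * (if y' ∈ Y then (1 : ℝ) else 0) = PY := by
        simp [hPY]
      simp only [hg, and_self, if_true, Real.exp_sub]
      simp_rw [← mul_div_assoc]
      rw [← Finset.sum_div, div_le_one (Real.exp_pos _)]
      rw [h3] at h2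
      simpa using h2
    · simp only [hg, h1, if_false, mul_one]
      exact (hP.sum_eq_one y b hyL).le
  calc _ = stateDist G P p k y * ∑ b, p y b * ∑ y', P y b y' * g y b y' := by
        simp_rw [Finset.mul_sum, mul_assoc]
    _ ≤ stateDist G P p k y * ∑ b, p y b := by
        refine mul_le_mul_of_nonneg_left (Finset.sum_le_sum fun b _ => ?_)
          (stateDist_nonneg hP hp k.isLt.le y)
        exact mul_le_of_le_one_right (hp.nonneg y b hyL) (hin b)
    _ = _ := by rw [hp.sum_eq_one y hyL, mul_one]

theorem sum_telescope_min {S : Type*} (ω : Fin T → S) (Φ : List S → ℝ) (w : List S → S → ℝ)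
    {j : ℕ} (hj : j ≤ T) (h1 : ∀ t : Fin T, (t : ℕ) < j →
      Φ (history ω t ++ [ω t]) = Φ (history ω t) + w (history ω t) (ω t))
    (h2 : ∀ t : Fin T, j ≤ t → w (history ω t) (ω t) = 0) :
    ∑ t, w (history ω t) (ω t) = Φ ((List.ofFn ω).take j) - Φ [] := by
  have h : ∀ t : Fin T, w (history ω t) (ω t) = Φ ((List.ofFn ω).take (min (t + 1) j)) -
      Φ ((List.ofFn ω).take (min t j)) := by
    intro t
    rcases lt_or_ge (t : ℕ) j with ht | ht
    · rw [min_eq_left ht, min_eq_left ht.le, ← history_append, h1 t ht, ← history]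
      ring
    · rw [h2 t ht, min_eq_right ht, min_eq_right (by omega), sub_self]
  simp_rw [h]
  rw [Fin.sum_univ_eq_sum_range (fun t => Φ ((List.ofFn ω).take (min (t + 1) j)) -
    Φ ((List.ofFn ω).take (min t j))), Finset.sum_range_sub
    (fun t => Φ ((List.ofFn ω).take (min t j)))]
  simp [min_eq_right hj]

theorem sum_deviation_eq {x : X} (a : A) (Y : Finset X) (r : ℝ)
    (ω : Fin T → Trajectory G A) {j : ℕ} (hj : j ≤ T) :
    ∑ t, deviation P x a (visits ((List.ofFn ω).take j) x a) Y r (history ω t) (ω t) =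
      r * (((∑ y ∈ Y, transits ((List.ofFn ω).take j) x a y : ℕ) : ℝ) -
        visits ((List.ofFn ω).take j) x a * ∑ y ∈ Y, P x a y) -
      r ^ 2 / 8 * visits ((List.ofFn ω).take j) x a := by
  set Φ : List (Trajectory G A) → ℝ := fun h =>
    r * (((∑ y ∈ Y, transits h x a y : ℕ) : ℝ) - visits h x a * ∑ y ∈ Y, P x a y) -
      r ^ 2 / 8 * visits h x a with hΦ
  have hΦ0 : Φ [] = 0 := by simp [hΦ, transits, visits]
  rw [sum_telescope_min ω Φ _ hj, hΦ0, sub_zero]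
  · intro t ht
    simp only [hΦ, deviation]
    simp_rw [visits_append, transits_append, Finset.sum_add_distrib, visits_singleton,
      transits_singleton]
    split_ifs with hv
    · push_cast; ring
    · have hmono : visits (history ω t ++ [ω t]) x a ≤ visits ((List.ofFn ω).take j) x a := by
        rw [history_append]
        exact visits_mono (List.take_prefix_take_left ht) x a
      rw [visits_append, visits_singleton] at hmono
      have h0 : (ω t).visit x a = 0 := by omega
      have h0' : ∀ y, (ω t).transit x a y = 0 := by
        intro y
        by_contra hne
        rw [Trajectory.visit] at h0
        rw [Trajectory.transit] at hne
        split_ifs at h0 with hex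
        split_ifs at hne with hex'
        · exact hex (hex'.imp fun k hk => ⟨hk.1, hk.2.1⟩)
        · exact hne rfl
      simp [h0, h0']
  · intro t ht
    have hmono : visits ((List.ofFn ω).take j) x a ≤ visits (history ω t) x a :=
      visits_mono (List.take_prefix_take_left ht) x a
    rw [deviation, if_neg (by omega)]

/-- The `L_1` distance of two probability vectors is attained on a set of coordinates. -/
theorem exists_half_sum_abs_le {s : Finset X} {u v : X → ℝ}
    (h : ∑ y ∈ s, u y = ∑ y ∈ s, v y) :
    ∃ Y ⊆ s, (∑ y ∈ s, |u y - v y|) / 2 = ∑ y ∈ Y, u y - ∑ y ∈ Y, v y := by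
  classical
  refine ⟨s.filter fun y => v y ≤ u y, Finset.filter_subset _ _, ?_⟩
  rw [← Finset.sum_sub_distrib, Finset.sum_filter]
  have e : ∑ y ∈ s, |u y - v y| =
      ∑ y ∈ s, (2 * (if v y ≤ u y then u y - v y else 0) - (u y - v y)) := by
    refine Finset.sum_congr rfl fun y _ => ?_
    split_ifs with hy
    · rw [abs_of_nonneg (sub_nonneg.2 hy)]; ring
    · rw [abs_of_neg (sub_neg.2 (not_le.1 hy))]; ring
  rw [e, Finset.sum_sub_distrib, ← Finset.mul_sum, Finset.sum_sub_distrib (f := u), h]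
  ring

end

section

/-! ### The confidence radius -/

variable {G : Layering X L} {P : X → A → X → ℝ}

theorem Layering.two_le_card (G : Layering X L) (hL : 1 ≤ L) : 2 ≤ Fintype.card X := by
  have hne : G.first ≠ G.last := by
    intro h
    have h0 := (G.layer_eq_zero_iff G.first).2 rfl
    rw [h, (G.layer_eq_last_iff G.last).2 rfl] at h0
    omega
  exact Fintype.one_lt_card_iff.2 ⟨_, _, hne⟩

theorem Layering.sum_card_states (G : Layering X L) :
    ∑ k ∈ Finset.range (L + 1), (G.states k).card = Fintype.card X := by
  rw [← Finset.card_univ, Finset.card_eq_sum_card_fiberwise (f := G.layer)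
    (t := Finset.range (L + 1)) fun x _ => by simpa using Nat.lt_succ_of_le (G.layer_le x)]
  refine Finset.sum_congr rfl fun k _ => congrArg _ ?_
  ext x
  simp [Layering.mem_states]

theorem two_le_card_div [Nonempty A] (G : Layering X L) (hL : 1 ≤ L) (hT : 0 < T) {δ : ℝ}
    (hδ : 0 < δ) (hδ1 : δ < 1) : 2 ≤ (T * Fintype.card X * Fintype.card A / δ : ℝ) := by
  have h1 : (1 : ℝ) ≤ T := by exact_mod_cast hT
  have h2 : (2 : ℝ) ≤ Fintype.card X := by exact_mod_cast G.two_le_card hL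
  have h3 : (1 : ℝ) ≤ Fintype.card A := by exact_mod_cast Fintype.card_pos (α := A)
  have h4 : 2 ≤ (T * Fintype.card X * Fintype.card A : ℝ) := by
    refine h2.trans ((le_mul_of_one_le_left (by linarith) h1).trans ?_)
    exact le_mul_of_one_le_right (by positivity) h3
  exact h4.trans (le_div_self (by linarith) hδ hδ1.le)

theorem half_le_log [Nonempty A] (G : Layering X L) (hL : 1 ≤ L) (hT : 0 < T) {δ : ℝ}
    (hδ : 0 < δ) (hδ1 : δ < 1) :
    1 / 2 ≤ Real.log (T * Fintype.card X * Fintype.card A / δ : ℝ) := by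
  have h := Real.log_le_log two_pos (two_le_card_div (A := A) G hL hT hδ hδ1)
  have := Real.log_two_gt_d9
  linarith

theorem one_le_card_states [Nonempty A] (hP : IsTransition G P) {x : X} (hx : G.layer x < L) :
    (1 : ℝ) ≤ (G.states (G.layer x + 1)).card := by
  exact_mod_cast Finset.card_pos.2 (hP.states_nonempty hx)

theorem radius_pos [Nonempty A] (hP : IsTransition G P) (hL : 1 ≤ L) (hT : 0 < T) {δ : ℝ}
    (hδ : 0 < δ) (hδ1 : δ < 1) (c : Counters X A) {x : X} (hx : G.layer x < L) (a : A) :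
    0 < c.radius G T δ x a := by
  have h1 := half_le_log (A := A) G hL hT hδ hδ1
  have h2 := one_le_card_states hP hx
  exact Real.sqrt_pos.2 (by positivity)

theorem one_le_radius [Nonempty A] (hP : IsTransition G P) (hL : 1 ≤ L) (hT : 0 < T) {δ : ℝ}
    (hδ : 0 < δ) (hδ1 : δ < 1) {c : Counters X A} {x : X} (hx : G.layer x < L) {a : A}
    (hN : c.N x a = 0) : 1 ≤ c.radius G T δ x a := by
  have h1 := half_le_log (A := A) G hL hT hδ hδ1
  have h2 := one_le_card_states hP hx
  refine Real.one_le_sqrt.2 ?_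
  rw [hN, Nat.cast_zero, max_eq_left zero_le_one, div_one]
  nlinarith

variable {M : AdversarialMDP X A L d T}
  {f : (X → A → X → (Fin d → ℝ)) → (X → A → X → ℝ) → ℝ} {η δ : ℝ}
  {q : List (Trajectory M.layering A) → (X → A → X → ℝ)}

/-- The occupancy measures chosen by the algorithm are positive. -/
theorem IsUCOREPS.isPositive [Nonempty A] (hq : IsUCOREPS M f η δ q) (hL : 1 ≤ L)
    (hδ : 0 < δ) (hδ1 : δ < 1) (h : List (Trajectory M.layering A)) (hh : h.length ≤ T) :
    IsPositive M.layering (q h) := by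
  induction h using List.reverseRecOn with
  | nil => rw [hq.init]; exact isPositive_initialOccupancy M.isTransition
  | append_singleton h U ih =>
    rw [List.length_append, List.length_singleton] at hh
    obtain ⟨z, -, hmem, hmin⟩ := hq.step h U (by omega)
    have hT : 0 < T := by omega
    obtain ⟨q', hq', hpos⟩ := exists_inConfidenceSet_isPositive (T := T) (δ := δ) M.isTransition
      (isConsistent_countersAfter (h ++ [U]))
      (fun x a hx => radius_pos M.isTransition hL hT hδ hδ1 _ hx a)
      (fun x a hx hN => one_le_radius M.isTransition hL hT hδ hδ1 hx hN)
    exact InConfidenceSet.isPositive_of_min (ih (by omega)) hq' hpos hmem hmin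

theorem visits_le_length (h : List (Trajectory G A)) (x : X) (a : A) :
    visits h x a ≤ h.length := by
  refine (List.sum_le_card_nsmul _ 1 fun n hn => ?_).trans (by simp)
  obtain ⟨U, -, rfl⟩ := List.mem_map.1 hn
  exact U.visit_le_one x a

/-- If the estimate of the transition function deviates from it, then so do the transitions to
some set of states. -/
theorem exists_deviation [Nonempty A] (hP : IsTransition G P) (hL : 1 ≤ L)
    (hδ : 0 < δ) (hδ1 : δ < 1) (ω : Fin T → Trajectory G A) (t : Fin T) {x : X}
    (hx : G.layer x < L) (a : A) (hN : (countersAfter (history ω t)).N x a ≠ 0)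
    (hdev : 3 / 2 * (countersAfter (history ω t)).radius G T δ x a <
      ∑ y ∈ G.states (G.layer x + 1), |(countersAfter (history ω t)).estimate x a y - P x a y|) :
    ∃ n ∈ Finset.Icc 1 T, ∃ Y ∈ (G.states (G.layer x + 1)).powerset,
      2 * (G.states (G.layer x + 1)).card *
          Real.log (T * Fintype.card X * Fintype.card A / δ) ≤
        ∑ t, deviation P x a n Y (3 * √(2 * (G.states (G.layer x + 1)).card *
          Real.log (T * Fintype.card X * Fintype.card A / δ) / n)) (history ω t) (ω t) := by
  have hT : 0 < T := t.pos
  obtain ⟨h', hpre, h1, h2⟩ := exists_prefix_counters (history ω t)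
  set c := countersAfter (history ω t) with hc
  have hpre2 : h' <+: List.ofFn ω := hpre.trans (List.take_prefix _ _)
  have hj : h'.length ≤ T := by simpa using hpre2.length_le
  have hh' : h' = (List.ofFn ω).take h'.length := List.prefix_iff_eq_take.1 hpre2
  have hsum : ∑ y ∈ G.states (G.layer x + 1), c.estimate x a y =
      ∑ y ∈ G.states (G.layer x + 1), P x a y := by
    rw [(isConsistent_countersAfter _).sum_estimate hx hN, G.sum_states_eq, hP.sum_eq_one x a hx]
    intro y hy
    by_contra h
    exact hy (hP.loop_free x a y h)
  obtain ⟨Y, hY, hYs⟩ := exists_half_sum_abs_le hsum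
  have hN1 : 1 ≤ visits h' x a := by rw [← h1]; omega
  refine ⟨visits h' x a, Finset.mem_Icc.2 ⟨hN1, (visits_le_length _ _ _).trans hj⟩, Y,
    Finset.mem_powerset.2 hY, ?_⟩
  have hdevsum := sum_deviation_eq (P := P) (x := x) a Y
    (3 * √(2 * (G.states (G.layer x + 1)).card *
      Real.log (T * Fintype.card X * Fintype.card A / δ) / visits h' x a)) ω hj
  rw [← hh'] at hdevsum
  rw [hdevsum]
  set n := visits h' x a with hn
  have hn1 : (1 : ℝ) ≤ n := by exact_mod_cast hN1
  have hrad : c.radius G T δ x a = √(2 * (G.states (G.layer x + 1)).card *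
      Real.log (T * Fintype.card X * Fintype.card A / δ) / n) := by
    rw [Counters.radius, h1, max_eq_right hn1]
  rw [← hrad]
  have hrpos := radius_pos hP hL hT hδ hδ1 c hx a
  have hest : ∑ y ∈ Y, c.estimate x a y = ((∑ y ∈ Y, transits h' x a y : ℕ) : ℝ) / n := by
    simp_rw [Counters.estimate, h2, h1 x a]
    rw [← hn, max_eq_right hn1]
    rw [← Finset.sum_div, Nat.cast_sum]
  have hsq : c.radius G T δ x a ^ 2 * n = 2 * (G.states (G.layer x + 1)).card *
      Real.log (T * Fintype.card X * Fintype.card A / δ) := by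
    have h3 := half_le_log (A := A) G hL hT hδ hδ1
    have h4 := one_le_card_states hP hx
    have h5 : 0 ≤ 2 * ((G.states (G.layer x + 1)).card : ℝ) *
        Real.log (T * Fintype.card X * Fintype.card A / δ) :=
      mul_nonneg (by linarith) (by linarith)
    rw [hrad, Real.sq_sqrt (div_nonneg h5 (by linarith)), div_mul_cancel₀ _ (by linarith)]
  rw [← hsq]
  rw [hest] at hYs
  set ρ := c.radius G T δ x a
  set m := ((∑ y ∈ Y, transits h' x a y : ℕ) : ℝ)
  have h5 : 3 / 4 * ρ < m / n - ∑ y ∈ Y, P x a y := by linarith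
  have h6 : 3 / 4 * ρ * n ≤ m - n * ∑ y ∈ Y, P x a y := by
    have := mul_le_mul_of_nonneg_right h5.le (by linarith : (0 : ℝ) ≤ n)
    rw [sub_mul, div_mul_cancel₀ _ (by positivity)] at this
    linarith
  have h7 := mul_le_mul_of_nonneg_left h6 (by positivity : 0 ≤ 3 * ρ)
  have h8 : 0 ≤ ρ ^ 2 * n := by positivity
  nlinarith

/-- The total weight of the deviations of all state-action pairs. -/
theorem sum_exp_le [Nonempty A] (G : Layering X L) (hL : 1 ≤ L) (hT : 0 < T) (hδ : 0 < δ)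
    (hδ1 : δ < 1) (hm : ∀ x, G.layer x < L → 1 ≤ (G.states (G.layer x + 1)).card) :
    ∑ x ∈ Finset.univ.filter (fun x => G.layer x < L), ∑ _a : A, ∑ _n ∈ Finset.Icc 1 T,
      ∑ _Y ∈ (G.states (G.layer x + 1)).powerset,
        Real.exp (-(2 * (G.states (G.layer x + 1)).card *
          Real.log (T * Fintype.card X * Fintype.card A / δ))) ≤ δ := by
  set K := (T * Fintype.card X * Fintype.card A / δ : ℝ) with hK
  have hK2 : 2 ≤ K := two_le_card_div G hL hT hδ hδ1
  have hK0 : 0 < K := by linarith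
  have key : ∀ x, G.layer x < L → ∑ _Y ∈ (G.states (G.layer x + 1)).powerset,
      Real.exp (-(2 * (G.states (G.layer x + 1)).card * Real.log K)) ≤ 1 / K := by
    intro x hx
    obtain ⟨m, hm'⟩ := Nat.exists_eq_add_of_le (hm x hx)
    rw [Finset.sum_const, Finset.card_powerset, nsmul_eq_mul, hm']
    have e : Real.exp (-(2 * ((1 + m : ℕ) : ℝ) * Real.log K)) = (1 / K) ^ (2 * (1 + m)) := by
      rw [one_div, inv_pow, Real.exp_neg, ← Real.exp_log (pow_pos hK0 (2 * (1 + m))),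
        Real.log_pow]
      push_cast; rfl
    rw [e]
    have h1 : 2 * (1 / K) ≤ 1 := by rw [mul_one_div, div_le_one hK0]; exact hK2
    have h2 : 1 / K ≤ 1 := by rw [div_le_one hK0]; linarith
    have h0 : 0 ≤ 1 / K := by positivity
    calc ((2 ^ (1 + m) : ℕ) : ℝ) * (1 / K) ^ (2 * (1 + m)) =
          (2 * (1 / K)) ^ (1 + m) * (1 / K) ^ m * (1 / K) := by push_cast; ring
      _ ≤ 1 * (1 / K) := by
          refine mul_le_mul_of_nonneg_right (mul_le_one₀ (pow_le_one₀ (by positivity) h1)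
            (pow_nonneg h0 _) (pow_le_one₀ h0 h2)) h0
      _ = _ := one_mul _
  calc _ ≤ ∑ x : X, ∑ _a : A, ∑ _n ∈ Finset.Icc 1 T, 1 / K := by
        refine (Finset.sum_le_sum fun x hx => Finset.sum_le_sum fun a _ =>
          Finset.sum_le_sum fun n _ => key x (Finset.mem_filter.1 hx).2).trans ?_
        exact Finset.sum_le_sum_of_subset_of_nonneg (Finset.filter_subset _ _)
          fun _ _ _ => by positivity
    _ = δ := by
        simp only [Finset.sum_const, Finset.card_univ, Nat.card_Icc, Nat.add_sub_cancel,
          nsmul_eq_mul]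
        have h1 : (T : ℝ) ≠ 0 := by exact_mod_cast hT.ne'
        have h2 : (Fintype.card A : ℝ) ≠ 0 := by exact_mod_cast Fintype.card_ne_zero
        have h3 : (Fintype.card X : ℝ) ≠ 0 := by
          have := G.two_le_card hL
          exact_mod_cast (by omega : Fintype.card X ≠ 0)
        rw [hK]; field_simp

end

/-! ### The regret of a run -/

/-- The distance of two transition functions along a trajectory. -/
def Trajectory.error {G : Layering X L} (U : Trajectory G A) (P P' : X → A → X → ℝ) : ℝ :=
  ∑ k : Fin L, ∑ x', |P (U.state k.castSucc) (U.action k) x' -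
    P' (U.state k.castSucc) (U.action k) x'|

theorem sum_abs_sub_le_two {G : Layering X L} {P P' : X → A → X → ℝ} (hP : IsTransition G P)
    (hP' : IsTransition G P') {x : X} (hx : G.layer x < L) (a : A) :
    ∑ x', |P x a x' - P' x a x'| ≤ 2 := by
  calc _ ≤ ∑ x', (P x a x' + P' x a x') := Finset.sum_le_sum fun x' _ => by
        have h1 := hP.nonneg x a x'
        have h2 := hP'.nonneg x a x'
        rw [abs_le]; constructor <;> linarith
    _ = 2 := by
        rw [Finset.sum_add_distrib, hP.sum_eq_one x a hx, hP'.sum_eq_one x a hx]; norm_num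

theorem Trajectory.error_mem_Icc {G : Layering X L} {P P' : X → A → X → ℝ}
    (hP : IsTransition G P) (hP' : IsTransition G P') (U : Trajectory G A) :
    U.error P P' ∈ Set.Icc 0 (2 * L : ℝ) := by
  refine ⟨Finset.sum_nonneg fun k _ => Finset.sum_nonneg fun _ _ => abs_nonneg _, ?_⟩
  refine (Finset.sum_le_card_nsmul _ _ 2 fun k _ =>
    sum_abs_sub_le_two hP hP' (by rw [U.layer_castSucc]; exact k.isLt) _).trans_eq ?_
  simp [mul_comm]

variable {M : AdversarialMDP X A L d T} {C : (Fin L → (Fin d → ℝ)) → ℝ≥0}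
  {f : (X → A → X → (Fin d → ℝ)) → (X → A → X → ℝ) → ℝ} {F η δ : ℝ}
  {q : List (Trajectory M.layering A) → (X → A → X → ℝ)}

theorem lipschitz_const_nonneg [Nonempty X] [Nonempty A] {g : (X → A → X → ℝ) → ℝ}
    (hg : IsLipschitzL1 F g) : 0 ≤ F := by
  have h := (abs_nonneg _).trans
    (hg 1 ⟨zero_le_one, le_rfl⟩ 0 ⟨le_rfl, zero_le_one⟩)
  refine nonneg_of_mul_nonneg_left h ?_
  simp only [Pi.one_apply, Pi.zero_apply, sub_zero, abs_one, Finset.sum_const, nsmul_eq_mul,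
    mul_one, Finset.card_univ]
  positivity

theorem criterion_sub_le [Nonempty A] (hf : IsCriterionFunction M.layering C f)
    (hF0 : 0 ≤ F) (hF : ∀ l, IsLoss l → IsLipschitzL1 F (f l)) {l : X → A → X → (Fin d → ℝ)}
    (hl : IsLoss l) {P' : X → A → X → ℝ} (hP' : IsTransition M.layering P') {p : X → A → ℝ}
    (hp : IsPolicy M.layering p) :
    (C (expectedLoss M.layering M.P p l) : ℝ) - C (expectedLoss M.layering P' p l) ≤
      F * (L * ∑ U : Trajectory M.layering A, trajProb M.P p U * U.error M.P P') := by
  rw [hf.eq_criterion l hl M.P p M.isTransition hp, hf.eq_criterion l hl P' p hP' hp]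
  refine (le_abs_self _).trans ((hF l hl _ (occupancy_mem_cube M.isTransition hp) _
    (occupancy_mem_cube hP' hp)).trans (mul_le_mul_of_nonneg_left ?_ hF0))
  refine (sum_abs_occupancy_le M.isTransition hP' hp).trans_eq ?_
  rw [sum_stepError M.isTransition hp]
  rfl

theorem sum_abs_sub_induced_le [Nonempty A] (hq : IsUCOREPS M f η δ q) (hL : 1 ≤ L)
    (hδ : 0 < δ) (hδ1 : δ < 1) (ω : Fin T → Trajectory M.layering A) (t : Fin T) {x : X}
    (hx : M.layering.layer x < L) (a : A)
    (hdev : (countersAfter (history ω t)).N x a ≠ 0 →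
      ∑ y ∈ M.layering.states (M.layering.layer x + 1),
        |(countersAfter (history ω t)).estimate x a y - M.P x a y| ≤
      3 / 2 * (countersAfter (history ω t)).radius M.layering T δ x a) :
    ∑ x', |M.P x a x' - inducedTransition M.layering (q (history ω t)) x a x'| ≤
      5 / 2 * (countersAfter (history ω t)).radius M.layering T δ x a := by
  have hlen : (history ω t).length ≤ T := by rw [length_history]; exact t.isLt.le
  have hpos := hq.isPositive hL hδ hδ1 _ hlen
  have hPt := hpos.isTransition M.isTransition
  by_cases hN : (countersAfter (history ω t)).N x a = 0
  · have h1 := sum_abs_sub_le_two M.isTransition hPt hx a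
    have h2 := one_le_radius M.isTransition hL t.pos hδ hδ1 hx hN
    linarith
  · have hclose : ∑ x' ∈ M.layering.states (M.layering.layer x + 1),
        |inducedTransition M.layering (q (history ω t)) x a x' -
          (countersAfter (history ω t)).estimate x a x'| ≤
        (countersAfter (history ω t)).radius M.layering T δ x a := by
      rcases List.eq_nil_or_concat' (history ω t) with h | ⟨h, U, h'⟩
      · exact absurd (by rw [h]; rfl) hN
      · obtain ⟨z, -, hmem, -⟩ := hq.step h U (by
          have := length_history ω t
          rw [h', List.length_append, List.length_singleton] at this
          omega)
        rw [← h'] at hmem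
        exact hmem.close x a hx (hpos.sum_pos M.isTransition hx a).ne'
    rw [← M.layering.sum_states_eq (k := M.layering.layer x + 1)]
    · calc _ ≤ ∑ x' ∈ M.layering.states (M.layering.layer x + 1),
            (|inducedTransition M.layering (q (history ω t)) x a x' -
              (countersAfter (history ω t)).estimate x a x'| +
            |(countersAfter (history ω t)).estimate x a x' - M.P x a x'|) := by
            refine Finset.sum_le_sum fun x' _ => ?_
            rw [abs_sub_comm]
            exact abs_sub_le _ _ _
        _ ≤ _ := by
            rw [Finset.sum_add_distrib]
            linarith [hdev hN]
    · intro y hy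
      have h1 : M.P x a y = 0 := by
        by_contra h
        exact hy (M.isTransition.loop_free x a y h)
      have h2 : inducedTransition M.layering (q (history ω t)) x a y = 0 := by
        by_contra h
        exact hy (hPt.loop_free x a y h)
      rw [h1, h2, sub_zero, abs_zero]

theorem sum_sqrt_card_states_le (G : Layering X L) :
    ∑ k : Fin L, √((G.states (k + 1)).card) * √((G.states k).card) ≤ Fintype.card X := by
  have h1 : ∑ k : Fin L, ((G.states k).card : ℝ) ≤ Fintype.card X := by
    rw [← G.sum_card_states, Nat.cast_sum, Finset.sum_range_succ,
      Fin.sum_univ_eq_sum_range (fun k => ((G.states k).card : ℝ))]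
    exact le_add_of_nonneg_right (Nat.cast_nonneg _)
  have h2 : ∑ k : Fin L, ((G.states (k + 1)).card : ℝ) ≤ Fintype.card X := by
    rw [← G.sum_card_states, Nat.cast_sum, Finset.sum_range_succ',
      Fin.sum_univ_eq_sum_range (fun k => ((G.states (k + 1)).card : ℝ))]
    exact le_add_of_nonneg_right (Nat.cast_nonneg _)
  have h3 : ∑ k : Fin L, √((G.states (k + 1)).card) * √((G.states k).card) ≤
      ∑ k : Fin L, (((G.states (k + 1)).card : ℝ) + (G.states k).card) / 2 := by
    refine Finset.sum_le_sum fun k _ => ?_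
    have e1 := Real.sq_sqrt (Nat.cast_nonneg (α := ℝ) (G.states (k + 1)).card)
    have e2 := Real.sq_sqrt (Nat.cast_nonneg (α := ℝ) (G.states k).card)
    nlinarith [sq_nonneg (√((G.states (k + 1)).card) - √((G.states k).card))]
  rw [← Finset.sum_div, Finset.sum_add_distrib] at h3
  linarith

theorem sum_radius_le [Nonempty A] (G : Layering X L) (hL : 1 ≤ L)
    (hδ : 0 < δ) (hδ1 : δ < 1) (hT : 0 < T) (ω : Fin T → Trajectory G A) :
    ∑ t, ∑ k : Fin L, (countersAfter (history ω t)).radius G T δ ((ω t).state k.castSucc)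
        ((ω t).action k) ≤
      5 / 2 * √2 * Fintype.card X * √(T * Fintype.card A *
        Real.log (T * Fintype.card X * Fintype.card A / δ)) := by
  set l := Real.log (T * Fintype.card X * Fintype.card A / δ) with hl
  have hl0 : 0 ≤ l := by linarith [half_le_log (A := A) G hL hT hδ hδ1]
  rw [Finset.sum_comm]
  calc _ = ∑ k : Fin L, √(2 * (G.states (k + 1)).card * l) *
        ∑ t, 1 / √(max 1 ((countersAfter (history ω t)).N ((ω t).state k.castSucc)
          ((ω t).action k) : ℝ)) := by
        refine Finset.sum_congr rfl fun k _ => ?_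
        rw [Finset.mul_sum]
        refine Finset.sum_congr rfl fun t _ => ?_
        rw [Counters.radius, Trajectory.layer_castSucc, Real.sqrt_div' _ (by positivity),
          mul_one_div]
    _ ≤ ∑ k : Fin L, √(2 * (G.states (k + 1)).card * l) *
          (5 / 2 * √((G.states k).card * Fintype.card A * T)) :=
        Finset.sum_le_sum fun k _ =>
          mul_le_mul_of_nonneg_left (sum_one_div_sqrt_le ω k) (Real.sqrt_nonneg _)
    _ = 5 / 2 * √2 * √(T * Fintype.card A * l) *
          ∑ k : Fin L, √((G.states (k + 1)).card) * √((G.states k).card) := by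
        rw [Finset.mul_sum]
        refine Finset.sum_congr rfl fun k _ => ?_
        rw [Real.sqrt_mul (by positivity), Real.sqrt_mul (by positivity),
          Real.sqrt_mul (by positivity), Real.sqrt_mul (by positivity),
          Real.sqrt_mul (by positivity), Real.sqrt_mul (by positivity)]
        ring
    _ ≤ 5 / 2 * √2 * √(T * Fintype.card A * l) * Fintype.card X :=
        mul_le_mul_of_nonneg_left (sum_sqrt_card_states_le G) (by positivity)
    _ = _ := by ring

/-- The bound on the regret of a run in which the estimates of the transition function are
accurate, and the trajectories are typical. -/
theorem approxRegret_le [Nonempty A] (hL : 1 ≤ L) (hT : 0 < T)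
    (hf : IsCriterionFunction M.layering C f) (hF0 : 0 ≤ F)
    (hF : ∀ l, IsLoss l → IsLipschitzL1 F (f l)) (hδ : 0 < δ) (hδ1 : δ < 1)
    (hq : IsUCOREPS M f η δ q) (ω : Fin T → Trajectory M.layering A)
    (haz : ∑ t, (∑ U : Trajectory M.layering A,
        trajProb M.P (inducedPolicy M.layering (q (history ω t))) U *
          U.error M.P (inducedTransition M.layering (q (history ω t))) -
        (ω t).error M.P (inducedTransition M.layering (q (history ω t)))) ≤
      L * √(2 * T * Real.log (1 / δ)))
    (hdev : ∀ t x a, M.layering.layer x < L → (countersAfter (history ω t)).N x a ≠ 0 →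
      ∑ y ∈ M.layering.states (M.layering.layer x + 1),
        |(countersAfter (history ω t)).estimate x a y - M.P x a y| ≤
      3 / 2 * (countersAfter (history ω t)).radius M.layering T δ x a) :
    approxRegret M C q ω ≤ 3 * F * L * Fintype.card X *
      (2 * √(T * Real.log (L / δ)) + 3 * √(T * Fintype.card A *
        Real.log (T * Fintype.card X * Fintype.card A / δ))) := by
  set s₁ := √(T * Real.log (L / δ)) with hs₁
  set s₂ := √(T * Fintype.card A * Real.log (T * Fintype.card X * Fintype.card A / δ)) with hs₂
  have hpos : ∀ t : Fin T, IsPositive M.layering (q (history ω t)) := fun t =>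
    hq.isPositive hL hδ hδ1 _ (by rw [length_history]; exact t.isLt.le)
  have h1 : approxRegret M C q ω ≤ ∑ t, F * (L * ∑ U : Trajectory M.layering A,
      trajProb M.P (inducedPolicy M.layering (q (history ω t))) U *
        U.error M.P (inducedTransition M.layering (q (history ω t)))) :=
    Finset.sum_le_sum fun t _ => criterion_sub_le hf hF0 hF (M.isLoss t)
      ((hpos t).isTransition M.isTransition) ((hpos t).isPolicy M.isTransition)
  simp_rw [← Finset.mul_sum] at h1
  have h2 : ∑ t, (ω t).error M.P (inducedTransition M.layering (q (history ω t))) ≤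
      5 / 2 * (5 / 2 * √2 * Fintype.card X * s₂) := by
    calc _ ≤ ∑ t, ∑ k : Fin L, 5 / 2 * (countersAfter (history ω t)).radius M.layering T δ
          ((ω t).state k.castSucc) ((ω t).action k) := by
          refine Finset.sum_le_sum fun t _ => Finset.sum_le_sum fun k _ => ?_
          have hk : M.layering.layer ((ω t).state k.castSucc) < L := by
            rw [Trajectory.layer_castSucc]; exact k.isLt
          exact sum_abs_sub_induced_le hq hL hδ hδ1 ω t hk _ (hdev t _ _ hk)
      _ ≤ _ := by
          simp_rw [← Finset.mul_sum]
          exact mul_le_mul_of_nonneg_left (sum_radius_le M.layering hL hδ hδ1 hT ω) (by norm_num)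
  rw [Finset.sum_sub_distrib] at haz
  have hL' : (1 : ℝ) ≤ L := by exact_mod_cast hL
  have hLX : (L : ℝ) ≤ Fintype.card X := by
    have h3 : L ≤ Fintype.card X := by
      rw [← M.layering.sum_card_states, Finset.sum_range_succ]
      refine le_trans ?_ (Nat.le_add_right _ _)
      simpa using Finset.card_nsmul_le_sum (Finset.range L)
        (fun k => (M.layering.states k).card) 1 fun k hk =>
        Finset.card_pos.2 (M.isTransition.states_nonempty (Finset.mem_range.1 hk).le)
    exact_mod_cast h3
  have hsqrt : √2 ≤ 36 / 25 := Real.sqrt_le_iff.2 ⟨by norm_num, by norm_num⟩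
  have h4 : √(2 * T * Real.log (1 / δ)) ≤ 36 / 25 * s₁ := by
    rw [mul_assoc, Real.sqrt_mul zero_le_two]
    refine mul_le_mul hsqrt (Real.sqrt_le_sqrt (mul_le_mul_of_nonneg_left ?_ (Nat.cast_nonneg _)))
      (Real.sqrt_nonneg _) (by norm_num)
    exact Real.log_le_log (by positivity) (div_le_div_of_nonneg_right hL' hδ.le)
  have hs1 : 0 ≤ s₁ := Real.sqrt_nonneg _
  have hs2 : 0 ≤ s₂ := Real.sqrt_nonneg _
  have h5 : L * √(2 * T * Real.log (1 / δ)) ≤ 6 * (Fintype.card X * s₁) := by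
    have h6 := mul_le_mul hLX h4 (Real.sqrt_nonneg _) (Nat.cast_nonneg _)
    have h7 : (0 : ℝ) ≤ Fintype.card X * s₁ := by positivity
    linarith
  have h6 : 5 / 2 * (5 / 2 * √2 * Fintype.card X * s₂) ≤ 9 * (Fintype.card X * s₂) := by
    have h7 := mul_le_mul_of_nonneg_right hsqrt
      (by positivity : (0 : ℝ) ≤ Fintype.card X * s₂)
    linarith
  refine h1.trans ?_
  calc _ ≤ F * (L * (6 * (Fintype.card X * s₁) + 9 * (Fintype.card X * s₂))) := by
        gcongr
        linarith
    _ = _ := by ring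

/-! ### The probability of a large regret -/

theorem length_history_lt {S : Type*} (ω : Fin T → S) (t : Fin T) :
    (history ω t).length < T := by
  rw [length_history]; exact t.isLt

theorem exp_neg_azuma_exponent (hδ : 0 < δ) (hδ1 : δ < 1) (hL : 1 ≤ L) (hT : 0 < T) :
    Real.exp (-(2 * (L * √(2 * T * Real.log (1 / δ))) ^ 2 / (T * (2 * L) ^ 2))) = δ := by
  have hT' : (T : ℝ) ≠ 0 := by exact_mod_cast hT.ne'
  have hL' : (L : ℝ) ≠ 0 := by exact_mod_cast (by omega : L ≠ 0)
  have h0 : 0 ≤ Real.log (1 / δ) := Real.log_nonneg (by rw [le_div_iff₀ hδ]; linarith)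
  rw [mul_pow, Real.sq_sqrt (by positivity)]
  have e : 2 * ((L : ℝ) ^ 2 * (2 * T * Real.log (1 / δ))) / (T * (2 * L) ^ 2) =
      Real.log (1 / δ) := by field_simp
  rw [e, one_div, Real.log_inv, neg_neg, Real.exp_log hδ]

end UCOREPS

end

theorem theorem5p2 {X A : Type*} [Fintype X] [Fintype A] [Nonempty A] {L d T : ℕ} (hL : 1 ≤ L)
    (M : UCOREPS.AdversarialMDP X A L d T)
    (C : (Fin L → (Fin d → ℝ)) → NNReal)
    (f : (X → A → X → (Fin d → ℝ)) → (X → A → X → ℝ) → ℝ)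
    (hf : UCOREPS.IsCriterionFunction M.layering C f)
    (F : ℝ) (hF : ∀ l, UCOREPS.IsLoss l → UCOREPS.IsLipschitzL1 F (f l))
    (η δ : ℝ) (hη : 0 < η) (hδ : 0 < δ) (hδ1 : δ < 1)
    (q : List (UCOREPS.Trajectory M.layering A) → (X → A → X → ℝ))
    (hq : UCOREPS.IsUCOREPS M f η δ q) :
    1 - 2 * δ ≤ UCOREPS.probability M q
      {ω | UCOREPS.approxRegret M C q ω ≤
        3 * F * L * Fintype.card X *
          (2 * √(T * Real.log (L / δ)) +
            3 * √(T * Fintype.card A *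
              Real.log (T * Fintype.card X * Fintype.card A / δ)))} := by
  classical
  open UCOREPS in
  rcases Nat.eq_zero_or_pos T with rfl | hT
  · have h : probability M q {ω | approxRegret M C q ω ≤ 3 * F * L * Fintype.card X *
          (2 * √((0 : ℕ) * Real.log (L / δ)) + 3 * √((0 : ℕ) * Fintype.card A *
              Real.log ((0 : ℕ) * Fintype.card X * Fintype.card A / δ)))} = 1 := by
      simp [probability, approxRegret, runProb]
    rw [h]
    linarith
  have : Nonempty X := ⟨M.layering.first⟩
  have hF0 : 0 ≤ F := lipschitz_const_nonneg (hF (fun _ _ _ _ => 0) fun _ _ _ _ => by simp)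
  have hpos : ∀ h, h.length < T → IsPositive M.layering (q h) := fun h hh =>
    hq.isPositive hL hδ hδ1 h hh.le
  set p : List (Trajectory M.layering A) → Trajectory M.layering A → ℝ := fun h U =>
    trajProb M.P (inducedPolicy M.layering (q h)) U with hp
  have hp0 : ∀ h, h.length < T → ∀ U, 0 ≤ p h U := fun h hh U =>
    trajProb_nonneg M.isTransition ((hpos h hh).isPolicy M.isTransition) U
  have hp1 : ∀ h, h.length < T → ∑ U, p h U = 1 := fun h hh =>
    sum_trajProb M.isTransition ((hpos h hh).isPolicy M.isTransition)
  set Z : List (Trajectory M.layering A) → Trajectory M.layering A → ℝ := fun h U =>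
    U.error M.P (inducedTransition M.layering (q h)) with hZ
  have haz := azuma hT (p := p) (Z := Z) (B := 2 * L) (by positivity) hp0 hp1
    (fun h hh U => U.error_mem_Icc M.isTransition ((hpos h hh).isTransition M.isTransition))
    (c := L * √(2 * T * Real.log (1 / δ))) (by positivity)
  rw [exp_neg_azuma_exponent hδ hδ1 hL hT] at haz
  set l := Real.log (T * Fintype.card X * Fintype.card A / δ) with hl
  set m : X → ℝ := fun x => (M.layering.states (M.layering.layer x + 1)).card with hm
  set D : X → A → ℕ → Finset X → (Fin T → Trajectory M.layering A) → ℝ := fun x a n Y ω =>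
    ∑ t, deviation M.P x a n Y (3 * √(2 * m x * l / n)) (history ω t) (ω t) with hD
  have hdev : ∀ x, M.layering.layer x < L → ∀ a n Y,
      (∑ ω, if 2 * m x * l ≤ D x a n Y ω then runProb M q ω else 0) ≤
        Real.exp (-(2 * m x * l)) := fun x hx a n Y =>
    sum_ite_le_exp_neg hp0 (fun h hh => sum_mul_exp_deviation_le M.isTransition
      ((hpos h hh).isPolicy M.isTransition) hx a n Y _ h) _
  have hbad : ∑ x ∈ Finset.univ.filter (fun x => M.layering.layer x < L), ∑ a : A,
      ∑ n ∈ Finset.Icc 1 T, ∑ Y ∈ (M.layering.states (M.layering.layer x + 1)).powerset,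
        (∑ ω, if 2 * m x * l ≤ D x a n Y ω then runProb M q ω else 0) ≤ δ :=
    (Finset.sum_le_sum fun x hx => Finset.sum_le_sum fun a _ => Finset.sum_le_sum fun n _ =>
      Finset.sum_le_sum fun Y _ => hdev x (Finset.mem_filter.1 hx).2 a n Y).trans
    (sum_exp_le M.layering hL hT hδ hδ1 fun x hx =>
      Finset.card_pos.2 (M.isTransition.states_nonempty hx))
  have htot : ∑ ω, runProb M q ω = 1 := sum_prod_history_eq_one hp1
  have hrun : ∀ ω, 0 ≤ runProb M q ω := fun ω =>
    Finset.prod_nonneg fun t _ => hp0 _ (length_history_lt ω t) _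
  set R := 3 * F * L * Fintype.card X * (2 * √(T * Real.log (L / δ)) +
    3 * √(T * Fintype.card A * l)) with hR
  set az : (Fin T → Trajectory M.layering A) → Prop := fun ω => L * √(2 * T * Real.log (1 / δ)) ≤
    ∑ t, (∑ U, p (history ω t) U * Z (history ω t) U - Z (history ω t) (ω t)) with haz'
  have hcover : ∀ ω, runProb M q ω ≤
      (if ω ∈ {ω | approxRegret M C q ω ≤ R} then runProb M q ω else 0) +
      ((if az ω then runProb M q ω else 0) +
      ∑ x ∈ Finset.univ.filter (fun x => M.layering.layer x < L), ∑ a : A,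
        ∑ n ∈ Finset.Icc 1 T, ∑ Y ∈ (M.layering.states (M.layering.layer x + 1)).powerset,
          if 2 * m x * l ≤ D x a n Y ω then runProb M q ω else 0) := by
    intro ω
    have hr := hrun ω
    have n0 : ∀ c : Prop, 0 ≤ if c then runProb M q ω else 0 := fun c => by
      split_ifs
      · exact hr
      · exact le_rfl
    have n1 : ∀ x a n, 0 ≤ ∑ Y ∈ (M.layering.states (M.layering.layer x + 1)).powerset,
        if 2 * m x * l ≤ D x a n Y ω then runProb M q ω else 0 := fun x a n =>
      Finset.sum_nonneg fun Y _ => n0 _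
    have n2 : ∀ x a, 0 ≤ ∑ n ∈ Finset.Icc 1 T,
        ∑ Y ∈ (M.layering.states (M.layering.layer x + 1)).powerset,
        if 2 * m x * l ≤ D x a n Y ω then runProb M q ω else 0 := fun x a =>
      Finset.sum_nonneg fun n _ => n1 x a n
    have n3 : ∀ x, 0 ≤ ∑ a : A, ∑ n ∈ Finset.Icc 1 T,
        ∑ Y ∈ (M.layering.states (M.layering.layer x + 1)).powerset,
        if 2 * m x * l ≤ D x a n Y ω then runProb M q ω else 0 := fun x =>
      Finset.sum_nonneg fun a _ => n2 x a
    have n4 := Finset.sum_nonneg fun x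
      (_ : x ∈ Finset.univ.filter fun x => M.layering.layer x < L) => n3 x
    by_cases h1 : az ω
    · rw [if_pos h1]
      linarith [n0 (ω ∈ {ω | approxRegret M C q ω ≤ R})]
    by_cases h2 : ∃ x, M.layering.layer x < L ∧ ∃ a : A, ∃ n ∈ Finset.Icc 1 T,
        ∃ Y ∈ (M.layering.states (M.layering.layer x + 1)).powerset, 2 * m x * l ≤ D x a n Y ω
    · obtain ⟨x, hx, a, n, hn, Y, hY, hle⟩ := h2
      have h3 := Finset.single_le_sum (s := Finset.univ.filter fun x => M.layering.layer x < L)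
        (fun x _ => n3 x) (Finset.mem_filter.2 ⟨Finset.mem_univ x, hx⟩)
      have h4 := Finset.single_le_sum (fun a _ => n2 x a) (Finset.mem_univ a)
      have h5 := Finset.single_le_sum (fun n _ => n1 x a n) hn
      have h6 := Finset.single_le_sum (f := fun Y =>
        if 2 * m x * l ≤ D x a n Y ω then runProb M q ω else 0) (fun Y _ => n0 _) hY
      rw [if_pos hle] at h6
      linarith [n0 (ω ∈ {ω | approxRegret M C q ω ≤ R}), n0 (az ω)]
    · have h3 : ω ∈ {ω | approxRegret M C q ω ≤ R} := by
        refine approxRegret_le hL hT hf hF0 hF hδ hδ1 hq ω (not_le.1 h1).le ?_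
        intro t x a hx hN
        by_contra h
        obtain ⟨n, hn, Y, hY, hle⟩ :=
          exists_deviation M.isTransition hL hδ hδ1 ω t hx a hN (not_le.1 h)
        exact h2 ⟨x, hx, a, n, hn, Y, hY, hle⟩
      rw [if_pos h3]
      linarith [n0 (az ω)]
  have hsum := Finset.sum_le_sum fun ω (_ : ω ∈ Finset.univ) => hcover ω
  rw [htot, Finset.sum_add_distrib, Finset.sum_add_distrib] at hsum
  have hswap : ∑ ω, ∑ x ∈ Finset.univ.filter (fun x => M.layering.layer x < L), ∑ a : A,
      ∑ n ∈ Finset.Icc 1 T, ∑ Y ∈ (M.layering.states (M.layering.layer x + 1)).powerset,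
        (if 2 * m x * l ≤ D x a n Y ω then runProb M q ω else 0) =
      ∑ x ∈ Finset.univ.filter (fun x => M.layering.layer x < L), ∑ a : A,
      ∑ n ∈ Finset.Icc 1 T, ∑ Y ∈ (M.layering.states (M.layering.layer x + 1)).powerset,
        ∑ ω, if 2 * m x * l ≤ D x a n Y ω then runProb M q ω else 0 := by
    rw [Finset.sum_comm]
    refine Finset.sum_congr rfl fun x _ => ?_
    rw [Finset.sum_comm]
    refine Finset.sum_congr rfl fun a _ => ?_
    rw [Finset.sum_comm]
    exact Finset.sum_congr rfl fun n _ => Finset.sum_comm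
  rw [hswap] at hsum
  have haz2 : ∑ ω, (if az ω then runProb M q ω else 0) ≤ δ := haz
  have hfin : probability M q {ω | approxRegret M C q ω ≤ R} =
      ∑ ω, if ω ∈ {ω | approxRegret M C q ω ≤ R} then runProb M q ω else 0 := by
    rw [probability]
  rw [hfin]
  linarith
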